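/- All vector spaces and Lie algebras are over $\mathbb{C}$. Let $\hat{\mathfrak{sl}}_2=\mathfrak{sl}_2\otimes\mathbb{C}[t,t^{-1}]\oplus\mathbb{C}K$ be the affine Lie algebra, with $K$ central and $[x_m,y_n]=[x,y]_{m+n}+m\operatorname{tr}(xy)\,\delta_{m+n,0}K$ for $x_n=x\otimes t^n$, and let $e,h,f$ be the standard basis of $\mathfrak{sl}_2$. Let $\mathcal{L}=\bigoplus_{s\in\mathbb{Z}}\mathbb{C}L_s\oplus\mathbb{C}C$ be the Virasoro algebra, with $C$ central and $[L_m,L_n]=(m-n)L_{m+n}+\frac{m^3-m}{12}\delta_{m+n,0}C$. Let $k,c\in\mathbb{C}$, $\lambda,\mu\in\mathbb{C}\setminus\{0\}$ and $(a,b)\in\mathbb{C}^2\setminus\{(0,0)\}$. Let $N\subseteq\hat{\mathfrak{sl}}_2$ be the subalgebra spanned by $e_n,f_{n+1},h_{n+1}$ $(n\ge 0)$ and $K$, and let $\mathbb{C}v$ be the one-dimensional $N$-module with $e_0v=\lambda v$, $f_1v=\mu v$, $Kv=kv$ and $e_{n+1}v=f_{n+2}v=h_{n+1}v=0$ for $n\ge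 0$. The universal Whittaker module is $\operatorname{Wh}^k(\lambda,\mu)=U(\hat{\mathfrak{sl}}_2)\otimes_{U(N)}\mathbb{C}v$, with Whittaker vector $w=1\otimes v$. Let $N_{\mathcal{L}}=\bigoplus_{s\ge 1}\mathbb{C}L_s\oplus\mathbb{C}C\subseteq\mathcal{L}$, and let $\mathbb{C}u$ be the one-dimensional $N_{\mathcal{L}}$-module with $L_1u=au$, $L_2u=bu$, $Cu=cu$ and $L_su=0$ for $s\ge 3$. The universal Virasoro Whittaker module is $\operatorname{Wh}^c_{\mathrm{Vir}}(a,b)=U(\mathcal{L})\otimes_{U(N_{\mathcal{L}})}\mathbb{C}u$, with Whittaker vector $w'=1\otimes u$. Then the vectors $$\prod_{i=0}^\infty (e_{-i-1})^{k_{i+1}}(h_{-i})^{l_i}(f_{-i})^{m_i}\,w,$$ where $(k_i)_{i\ge 1}$, $(l_i)_{i\ge 0}$, $(m_i)_{i\ge 0}$ run over the finitely supported sequences in $\mathbb{Z}_{\ge 0}$ and the factors of the product are written from left to right with increasing $i$, form a basis of $\operatorname{Wh}^k(\lambda,\mu)$. The unique linear map $\varphi^+\colon\operatorname{Wh}^k(\lambda,\mu)\to\operatorname{Wh}^c_{\mathrm{Vir}}(a,b)$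 with $$\prod_{i=0}^\infty (e_{-i-1})^{k_{i+1}}(h_{-i})^{l_i}(f_{-i})^{m_i}\,w\;\longmapsto\;\prod_{i=0}^\infty (L_{-3i})^{l_i}(L_{-3i-1})^{m_i}(L_{-3(i+1)+1})^{k_{i+1}}\,w'$$ (that is, $e_{-i-1}\mapsto L_{-3(i+1)+1}$, $h_{-i}\mapsto L_{-3i}$, $f_{-i}\mapsto L_{-3i-1}$ for $i\ge 0$ and $w\mapsto w'$; the right-hand side is the ordered product $L_0^{l_0}L_{-1}^{m_0}L_{-2}^{k_1}L_{-3}^{l_1}L_{-4}^{m_1}L_{-5}^{k_2}\cdots w'$) is an isomorphism of vector spaces. -/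

import Mathlib

noncomputable section

namespace WhittakerIso

open scoped TensorProduct

attribute [local instance 100] LieRing.ofAssociativeRing

/-! ### Induced modules -/

section Induced

variable {g : Type*} [LieRing g] [LieAlgebra ℂ g] (H : LieSubalgebra ℂ g)
  {M : Type*} [AddCommGroup M] [Module ℂ M]

/-- The algebra homomorphism `U(H) → U(g)` induced by the inclusion `H ⊆ g`. -/
def envelopingIncl : UniversalEnvelopingAlgebra ℂ H →ₐ[ℂ] UniversalEnvelopingAlgebra ℂ g :=
  UniversalEnvelopingAlgebra.lift ℂ ((UniversalEnvelopingAlgebra.ι ℂ).comp H.incl)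

/-- The `U(g)`-submodule of `U(g) ⊗_ℂ M` generated by all `ub ⊗ v - u ⊗ bv` with `u ∈ U(g)`,
`b ∈ U(H)`, `v ∈ M`. -/
def inducedRelations (ρ : H →ₗ⁅ℂ⁆ Module.End ℂ M) :
    Submodule (UniversalEnvelopingAlgebra ℂ g) (UniversalEnvelopingAlgebra ℂ g ⊗[ℂ] M) :=
  Submodule.span _ {z | ∃ (u : UniversalEnvelopingAlgebra ℂ g)
    (b : UniversalEnvelopingAlgebra ℂ H) (v : M),
    z = (u * envelopingIncl H b) ⊗ₜ[ℂ] v -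
      u ⊗ₜ[ℂ] (UniversalEnvelopingAlgebra.lift ℂ ρ b v)}

/-- The induced module `U(g) ⊗_{U(H)} M` of a representation `ρ` of `H` on `M`, i.e. the tensor
product of the right `U(H)`-module `U(g)` and the left `U(H)`-module `M`. -/
abbrev InducedModule (ρ : H →ₗ⁅ℂ⁆ Module.End ℂ M) : Type _ :=
  (UniversalEnvelopingAlgebra ℂ g ⊗[ℂ] M) ⧸ inducedRelations H ρ

/-- The class of `u ⊗ v` in `U(g) ⊗_{U(H)} M`. -/
def InducedModule.tmul (ρ : H →ₗ⁅ℂ⁆ Module.End ℂ M) (u : UniversalEnvelopingAlgebra ℂ g) (v : M) :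
    InducedModule H ρ :=
  (inducedRelations H ρ).mkQ (u ⊗ₜ[ℂ] v)

/-- The one-dimensional representation on `ℂ` given by a character `χ`: `x` acts by `χ x`. -/
def charRep (χ : H →ₗ⁅ℂ⁆ ℂ) : H →ₗ⁅ℂ⁆ Module.End ℂ ℂ :=
  (Algebra.lmul ℂ ℂ).toLieHom.comp χ

end Induced

/-! ### Subalgebras given by a linear span, and their characters -/

section Span

variable {g : Type*} [LieRing g] [LieAlgebra ℂ g]

theorem lie_mem_of_span {S : Set g} {P : Submodule ℂ g} (hS : ∀ x ∈ S, ∀ y ∈ S, ⁅x, y⁆ ∈ P)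
    {x y : g} (hx : x ∈ Submodule.span ℂ S) (hy : y ∈ Submodule.span ℂ S) : ⁅x, y⁆ ∈ P := by
  induction hx using Submodule.span_induction with
  | zero => simp
  | add a b _ _ ha hb => rw [add_lie]; exact P.add_mem ha hb
  | smul c a _ ha => rw [smul_lie]; exact P.smul_mem c ha
  | mem a ha =>
    induction hy using Submodule.span_induction with
    | zero => simp
    | add b c _ _ hb hc => rw [lie_add]; exact P.add_mem hb hc
    | smul c b _ hb => rw [lie_smul]; exact P.smul_mem c hb
    | mem b hb => exact hS a ha b hb

/-- The linear span of a set as a Lie subalgebra, if brackets of elements of the set lie in it. -/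
def spanSubalgebra (S : Set g) (hS : ∀ x ∈ S, ∀ y ∈ S, ⁅x, y⁆ ∈ Submodule.span ℂ S) :
    LieSubalgebra ℂ g where
  __ := Submodule.span ℂ S
  lie_mem' hx hy := lie_mem_of_span hS hx hy

/-- The restriction to a subalgebra of a linear functional that vanishes on brackets, as a
character. -/
def restrictChar (H : LieSubalgebra ℂ g) (φ : g →ₗ[ℂ] ℂ)
    (hφ : ∀ x ∈ H, ∀ y ∈ H, φ ⁅x, y⁆ = 0) : H →ₗ⁅ℂ⁆ ℂ where
  toLinearMap := φ.comp H.toSubmodule.subtype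
  map_lie' {x y} := by
    rw [LieRing.of_associative_ring_bracket, mul_comm, sub_self]
    exact hφ x.1 x.2 y.1 y.2

end Span

/-! ### The affine Lie algebra of `sl₂` -/

/-- The Lie algebra `sl₂(ℂ)` of traceless matrices. -/
abbrev Sl2 := LieAlgebra.SpecialLinear.sl (Fin 2) ℂ

def sl2E : Sl2 := ⟨!![0, 1; 0, 0], by
  simp [LieAlgebra.SpecialLinear.sl, ← LieSubalgebra.mem_toSubmodule, Matrix.trace_fin_two]⟩
def sl2H : Sl2 := ⟨!![1, 0; 0, -1], by
  simp [LieAlgebra.SpecialLinear.sl, ← LieSubalgebra.mem_toSubmodule, Matrix.trace_fin_two]⟩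
def sl2F : Sl2 := ⟨!![0, 0; 1, 0], by
  simp [LieAlgebra.SpecialLinear.sl, ← LieSubalgebra.mem_toSubmodule, Matrix.trace_fin_two]⟩

theorem lie_HE : ⁅sl2H, sl2E⁆ = (2 : ℂ) • sl2E := by
  ext i j
  fin_cases i <;> fin_cases j <;>
    simp [sl2H, sl2E, LieRing.of_associative_ring_bracket, one_add_one_eq_two]

theorem lie_HF : ⁅sl2H, sl2F⁆ = (-2 : ℂ) • sl2F := by
  ext i j
  fin_cases i <;> fin_cases j <;>
    simp [sl2H, sl2F, LieRing.of_associative_ring_bracket]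
  norm_num

theorem lie_EF : ⁅sl2E, sl2F⁆ = sl2H := by
  ext i j
  fin_cases i <;> fin_cases j <;>
    simp [sl2H, sl2F, sl2E, LieRing.of_associative_ring_bracket]

/-- The form `-tr(xy)` on `sl₂`, the negative of the normalised invariant form `(x, y) = tr(xy)`. -/
def negForm : LinearMap.BilinForm ℂ Sl2 :=
  LinearMap.mk₂ ℂ (fun x y => -Matrix.trace (x.1 * y.1))
    (by intros; simp [add_mul]; ring) (by intros; simp)
    (by intros; simp [mul_add]; ring) (by intros; simp)

theorem negForm_symm : negForm.IsSymm := ⟨fun x y => by simp [negForm, Matrix.trace_mul_comm x.1]⟩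

theorem negForm_invariant : negForm.lieInvariant Sl2 := by
  intro x y z
  have := Matrix.trace_mul_cycle y.1 z.1 x.1
  simp only [negForm, LinearMap.mk₂_apply, LieSubalgebra.coe_bracket,
    LieRing.of_associative_ring_bracket, sub_mul, mul_sub, Matrix.trace_sub, Matrix.mul_assoc] at *
  rw [this]
  ring

/-- The cocycle `(x tᵐ, y tⁿ) ↦ m tr(xy) δ_{m+n,0}` on the loop algebra of `sl₂`. For a bilinear
form `Φ`, `twoCocycleOfBilinear` has the value `n Φ(x, y) δ_{m+n,0}`, whence the form `-tr(xy)`. -/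
def cocycle : LieModule.Cohomology.twoCocycle ℂ (LieAlgebra.loopAlgebra ℂ ℤ Sl2)
    (TrivialLieModule ℂ (LieAlgebra.loopAlgebra ℂ ℤ Sl2) ℂ) :=
  LieAlgebra.LoopAlgebra.twoCocycleOfBilinear ℂ ℤ Sl2 negForm negForm_invariant negForm_symm

/-- The affine Lie algebra `sl₂ ⊗ ℂ[t, t⁻¹] ⊕ ℂ K`. -/
abbrev AffineSl2 := LieAlgebra.ofTwoCocycle cocycle

/-- The linear identification of `sl₂ ⊗ ℂ[t, t⁻¹] ⊕ ℂ` with `AffineSl2`. -/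
def affOf : (LieAlgebra.loopAlgebra ℂ ℤ Sl2 × ℂ) ≃ₗ[ℂ] AffineSl2 where
  toFun p := LieAlgebra.ofProd cocycle (p.1, (TrivialLieModule.equiv ℂ _ ℂ).symm p.2)
  invFun x := (((LieAlgebra.ofProd cocycle).symm x).1,
    TrivialLieModule.equiv ℂ _ ℂ ((LieAlgebra.ofProd cocycle).symm x).2)
  map_add' _ _ := rfl
  map_smul' _ _ := rfl
  left_inv _ := rfl
  right_inv _ := rfl

theorem lie_affOf (x y : LieAlgebra.loopAlgebra ℂ ℤ Sl2 × ℂ) :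
    ⁅affOf x, affOf y⁆ = affOf (⁅x.1, y.1⁆,
      LieAlgebra.LoopAlgebra.residuePairing ℂ ℤ Sl2 negForm x.1 y.1) := by
  have hz (u : LieAlgebra.loopAlgebra ℂ ℤ Sl2)
      (v : TrivialLieModule ℂ (LieAlgebra.loopAlgebra ℂ ℤ Sl2) ℂ) : ⁅u, v⁆ = 0 :=
    trivial_lie_zero _ _ u v
  change LieAlgebra.ofProd cocycle (_, _ + _ - _) = LieAlgebra.ofProd cocycle (_, _)
  rw [hz, hz, add_zero, sub_zero]
  rfl

/-- The element `xₙ = x ⊗ tⁿ`. -/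
def loop (x : Sl2) (n : ℤ) : AffineSl2 := affOf (AddMonoidAlgebra.single n 1 ⊗ₜ[ℂ] x, 0)

/-- The central element `K`. -/
def affK : AffineSl2 := affOf (0, 1)

/-- `[xₘ, yₙ] = [x, y]ₘ₊ₙ + m tr(xy) δ_{m+n,0} K`. -/
theorem lie_loop (x y : Sl2) (m n : ℤ) :
    ⁅loop x m, loop y n⁆ = loop ⁅x, y⁆ (m + n) +
      (if m + n = 0 then (m : ℂ) * Matrix.trace (x.1 * y.1) else 0) • affK := by
  rw [loop, loop, lie_affOf, loop, affK, ← map_smul, ← map_add]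
  congr 1
  refine Prod.ext ?_ ?_
  · simp only [LieAlgebra.ExtendScalars.bracket_tmul, AddMonoidAlgebra.single_mul_single,
      mul_one, Prod.fst_add, Prod.smul_fst, smul_zero, add_zero]
  · simp only [LieAlgebra.LoopAlgebra.residuePairing_apply_apply,
      LieAlgebra.LoopAlgebra.toFinsupp_single_tmul, Finsupp.single_apply]
    rw [Finsupp.sum_single_index (by simp)]
    by_cases hmn : m + n = 0
    · obtain rfl : n = -m := by omega
      simp [negForm]
    · have : ¬ m = -n := by omega
      simp [hmn, this]

theorem lie_affK (x : AffineSl2) : ⁅x, affK⁆ = 0 := by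
  obtain ⟨x, rfl⟩ := affOf.surjective x
  rw [affK, lie_affOf]
  have h0 : ⁅x.1, (0 : LieAlgebra.loopAlgebra ℂ ℤ Sl2)⁆ = 0 := lie_zero x.1
  dsimp only
  rw [h0, map_zero]
  exact map_zero affOf

theorem loop_smul (c : ℂ) (x : Sl2) (n : ℤ) : loop (c • x) n = c • loop x n := by
  rw [loop, loop, ← map_smul, TensorProduct.tmul_smul, Prod.smul_mk, smul_zero]

theorem loop_zero (n : ℤ) : loop 0 n = 0 := by
  simpa using loop_smul 0 0 n

/-! ### The universal Whittaker module of affine `sl₂` -/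

/-- The spanning set `{eₙ, fₙ₊₁, hₙ₊₁, K | n ≥ 0}` of `N`. -/
def affGens : Set AffineSl2 :=
  {x | (∃ n : ℕ, x = loop sl2E n ∨ x = loop sl2F (n + 1) ∨ x = loop sl2H (n + 1)) ∨ x = affK}

/-- The linear functional sending `x` to
`lam * (coefficient of e₀) + mu * (coefficient of f₁) + k * (coefficient of K)`. -/
def affFunctional (k lam mu : ℂ) : AffineSl2 →ₗ[ℂ] ℂ where
  toFun x := lam * (LieAlgebra.LoopAlgebra.toFinsupp ℂ ℤ Sl2 (affOf.symm x).1 0).1 0 1 +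
    mu * (LieAlgebra.LoopAlgebra.toFinsupp ℂ ℤ Sl2 (affOf.symm x).1 1).1 1 0 +
    k * (affOf.symm x).2
  map_add' x y := by simp; ring
  map_smul' c x := by simp; ring

theorem affFunctional_loop (k lam mu : ℂ) (x : Sl2) (n : ℤ) :
    affFunctional k lam mu (loop x n) =
      lam * (if n = 0 then x.1 0 1 else 0) + mu * (if n = 1 then x.1 1 0 else 0) := by
  simp only [affFunctional, loop, LinearMap.coe_mk, AddHom.coe_mk, LinearEquiv.symm_apply_apply,
    LieAlgebra.LoopAlgebra.toFinsupp_single_tmul, Finsupp.single_apply, mul_zero, add_zero]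
  split_ifs <;> simp

theorem affFunctional_affK (k lam mu : ℂ) : affFunctional k lam mu affK = k := by
  simp [affFunctional, affK]

theorem affGens_lie (k lam mu : ℂ) : ∀ x ∈ affGens, ∀ y ∈ affGens,
    ⁅x, y⁆ ∈ Submodule.span ℂ affGens ⊓ LinearMap.ker (affFunctional k lam mu) := by
  have hE (m : ℤ) (hm : 1 ≤ m) : loop sl2E m ∈
      Submodule.span ℂ affGens ⊓ LinearMap.ker (affFunctional k lam mu) := by
    refine ⟨Submodule.subset_span (Or.inl ⟨m.toNat, Or.inl ?_⟩), ?_⟩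
    · congr; omega
    · have h1 : m ≠ 0 := by omega
      simp [affFunctional_loop, sl2E, h1]
  have hF (m : ℤ) (hm : 2 ≤ m) : loop sl2F m ∈
      Submodule.span ℂ affGens ⊓ LinearMap.ker (affFunctional k lam mu) := by
    refine ⟨Submodule.subset_span (Or.inl ⟨(m - 1).toNat, Or.inr (Or.inl ?_)⟩), ?_⟩
    · congr; omega
    · have h1 : m ≠ 1 := by omega
      simp [affFunctional_loop, sl2F, h1]
  have hH (m : ℤ) (hm : 1 ≤ m) : loop sl2H m ∈
      Submodule.span ℂ affGens ⊓ LinearMap.ker (affFunctional k lam mu) := by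
    refine ⟨Submodule.subset_span (Or.inl ⟨(m - 1).toNat, Or.inr (Or.inr ?_)⟩), ?_⟩
    · congr; omega
    · simp [affFunctional_loop, sl2H]
  have hEE : Matrix.trace (sl2E.1 * sl2E.1) = 0 := by simp [sl2E, Matrix.trace_fin_two]
  have hFF : Matrix.trace (sl2F.1 * sl2F.1) = 0 := by simp [sl2F, Matrix.trace_fin_two]
  have hEH : ⁅sl2E, sl2H⁆ = (-2 : ℂ) • sl2E := by rw [← lie_skew, lie_HE, neg_smul]
  have hFH : ⁅sl2F, sl2H⁆ = (2 : ℂ) • sl2F := by rw [← lie_skew, lie_HF, neg_smul, neg_neg]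
  have hFE : ⁅sl2F, sl2E⁆ = (-1 : ℂ) • sl2H := by rw [← lie_skew, lie_EF, neg_smul, one_smul]
  have key (x y : Sl2) (m n : ℤ) (hmn : m + n ≠ 0 ∨ Matrix.trace (x.1 * y.1) = 0) :
      ⁅loop x m, loop y n⁆ = loop ⁅x, y⁆ (m + n) := by
    rw [lie_loop]
    rcases hmn with hmn | hmn <;> simp [hmn]
  rintro x (⟨m, rfl | rfl | rfl⟩ | rfl) y (⟨n, rfl | rfl | rfl⟩ | rfl)
  all_goals first
    | (rw [lie_affK]; exact Submodule.zero_mem _)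
    | (rw [← lie_skew, lie_affK, neg_zero]; exact Submodule.zero_mem _)
    | (rw [key _ _ _ _ (Or.inr hEE), lie_self, loop_zero]; exact Submodule.zero_mem _)
    | (rw [key _ _ _ _ (Or.inl (by omega))]
       first
        | (rw [lie_self, loop_zero]; exact Submodule.zero_mem _)
        | (rw [lie_EF]; exact hH _ (by omega))
        | (rw [hFE, loop_smul]; exact Submodule.smul_mem _ _ (hH _ (by omega)))
        | (rw [lie_HE, loop_smul]; exact Submodule.smul_mem _ _ (hE _ (by omega)))
        | (rw [hEH, loop_smul]; exact Submodule.smul_mem _ _ (hE _ (by omega)))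
        | (rw [lie_HF, loop_smul]; exact Submodule.smul_mem _ _ (hF _ (by omega)))
        | (rw [hFH, loop_smul]; exact Submodule.smul_mem _ _ (hF _ (by omega))))

/-- The subalgebra `N = ⟨eₙ, fₙ₊₁, hₙ₊₁, K | n ≥ 0⟩_ℂ`. -/
def affN : LieSubalgebra ℂ AffineSl2 :=
  spanSubalgebra affGens fun x hx y hy => (affGens_lie 0 0 0 x hx y hy).1

/-- The character of `N` with `e₀ ↦ lam`, `f₁ ↦ mu`, `K ↦ k` and `eₙ₊₁, fₙ₊₂, hₙ₊₁ ↦ 0` for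
`n ≥ 0`. -/
def affChar (k lam mu : ℂ) : affN →ₗ⁅ℂ⁆ ℂ :=
  restrictChar affN (affFunctional k lam mu) fun _ hx _ hy =>
    (lie_mem_of_span (affGens_lie k lam mu) hx hy).2

/-- The universal Whittaker module of level `k` for affine `sl₂`. -/
abbrev WhAff (k lam mu : ℂ) : Type :=
  InducedModule affN (charRep affN (affChar k lam mu))

/-- The Whittaker vector `1 ⊗ v`. -/
def whAffVec (k lam mu : ℂ) : WhAff k lam mu := InducedModule.tmul affN _ 1 1

/-- The image of `xₙ` in the universal enveloping algebra. -/
def uLoop (x : Sl2) (n : ℤ) : UniversalEnvelopingAlgebra ℂ AffineSl2 :=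
  UniversalEnvelopingAlgebra.ι ℂ (loop x n)

/-- The vector `∏_{i ≥ 0} e_{-i-1}^{κ i} h_{-i}^{l i} f_{-i}^{m i} w`, where the factors are ordered
from left to right with increasing `i`. (Factors with `κ i = l i = m i = 0` are omitted.) -/
def affPBW (k lam mu : ℂ) (κ l m : ℕ →₀ ℕ) : WhAff k lam mu :=
  (((κ.support ∪ l.support ∪ m.support).sort (· ≤ ·)).map fun i : ℕ =>
    uLoop sl2E (-i - 1) ^ κ i * uLoop sl2H (-i) ^ l i * uLoop sl2F (-i) ^ m i).prod •
      whAffVec k lam mu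

/-! ### The Virasoro algebra -/

/-- The Virasoro algebra `⨁ₛ ℂ Lₛ ⊕ ℂ C`: the first component holds the coefficients of the `Lₛ`,
the second one that of `C`. -/
@[ext] structure Virasoro where
  wittPart : ℤ →₀ ℂ
  centralPart : ℂ

namespace Virasoro

def equivProd : Virasoro ≃ (ℤ →₀ ℂ) × ℂ where
  toFun x := (x.1, x.2)
  invFun p := ⟨p.1, p.2⟩

instance : AddCommGroup Virasoro := equivProd.addCommGroup
instance : Module ℂ Virasoro := equivProd.module ℂ

/-- `equivProd` as a linear equivalence. -/
def linearEquivProd : Virasoro ≃ₗ[ℂ] (ℤ →₀ ℂ) × ℂ where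
  __ := equivProd
  map_add' _ _ := rfl
  map_smul' _ _ := rfl

/-- The basis vector `Lₙ`. -/
def L (n : ℤ) : Virasoro := ⟨Finsupp.single n 1, 0⟩

/-- The central element `C`. -/
def C : Virasoro := ⟨0, 1⟩

/-- The bilinear map with `(Lₘ, Lₙ) ↦ (m - n) Lₘ₊ₙ + (m³ - m)/12 δ_{m+n,0} C` on Witt parts. -/
def bracketAux : (ℤ →₀ ℂ) →ₗ[ℂ] (ℤ →₀ ℂ) →ₗ[ℂ] Virasoro :=
  Finsupp.linearCombination ℂ fun m : ℤ => Finsupp.linearCombination ℂ fun n : ℤ =>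
    ((m : ℂ) - n) • L (m + n) + (if m + n = 0 then ((m : ℂ) ^ 3 - m) / 12 else 0) • C

theorem bracketAux_single (m n : ℤ) (a b : ℂ) :
    bracketAux (Finsupp.single m a) (Finsupp.single n b) = (a * b) • (((m : ℂ) - n) • L (m + n) +
      (if m + n = 0 then ((m : ℂ) ^ 3 - m) / 12 else 0) • C) := by
  rw [bracketAux, Finsupp.linearCombination_single, LinearMap.smul_apply,
    Finsupp.linearCombination_single, smul_smul]

theorem wittPart_add (x y : Virasoro) : (x + y).wittPart = x.wittPart + y.wittPart := rfl
theorem centralPart_add (x y : Virasoro) :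
    (x + y).centralPart = x.centralPart + y.centralPart := rfl
theorem wittPart_smul (c : ℂ) (x : Virasoro) : (c • x).wittPart = c • x.wittPart := rfl
theorem centralPart_smul (c : ℂ) (x : Virasoro) : (c • x).centralPart = c * x.centralPart := rfl
theorem wittPart_L (n : ℤ) : (L n).wittPart = Finsupp.single n 1 := rfl
theorem centralPart_L (n : ℤ) : (L n).centralPart = 0 := rfl
theorem wittPart_C : C.wittPart = 0 := rfl
theorem centralPart_C : C.centralPart = 1 := rfl

theorem bracketAux_skew (x y : ℤ →₀ ℂ) : bracketAux x y = -bracketAux y x := by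
  induction x using Finsupp.induction_linear with
  | zero => simp
  | add x x' h h' => rw [map_add, map_add, LinearMap.add_apply, h, h', neg_add]
  | single m a =>
    induction y using Finsupp.induction_linear with
    | zero => simp
    | add y y' h h' => rw [map_add, map_add, LinearMap.add_apply, h, h', neg_add]
    | single n b =>
      rw [bracketAux_single, bracketAux_single, add_comm n m]
      by_cases hmn : m + n = 0
      · obtain rfl : n = -m := by omega
        simp only [add_neg_cancel, if_true]
        push_cast
        module
      · simp only [hmn, if_false]
        module

theorem bracketAux_self (x : ℤ →₀ ℂ) : bracketAux x x = 0 := by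
  have h2 : (2 : ℂ) • bracketAux x x = 0 := by
    rw [two_smul]
    nth_rw 2 [bracketAux_skew]
    exact add_neg_cancel _
  simpa using h2

theorem bracketAux_leibniz (x y z : ℤ →₀ ℂ) :
    bracketAux x (bracketAux y z).wittPart =
      bracketAux (bracketAux x y).wittPart z + bracketAux y (bracketAux x z).wittPart := by
  induction x using Finsupp.induction_linear with
  | zero => simp [show (0 : Virasoro).wittPart = 0 from rfl]
  | add x x' h h' =>
    simp only [map_add, LinearMap.add_apply, wittPart_add, h, h']
    abel
  | single m a =>
  induction y using Finsupp.induction_linear with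
  | zero => simp [show (0 : Virasoro).wittPart = 0 from rfl]
  | add x x' h h' =>
    simp only [map_add, LinearMap.add_apply, wittPart_add, h, h']
    abel
  | single n b =>
  induction z using Finsupp.induction_linear with
  | zero => simp [show (0 : Virasoro).wittPart = 0 from rfl]
  | add x x' h h' =>
    simp only [map_add, wittPart_add, h, h']
    abel
  | single p c =>
    simp only [bracketAux_single, wittPart_add, wittPart_smul, wittPart_L, wittPart_C, smul_zero,
      add_zero, map_smul, LinearMap.smul_apply]
    rw [show n + (m + p) = m + (n + p) by ring, show m + n + p = m + (n + p) by ring]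
    by_cases h : m + (n + p) = 0
    · obtain rfl : p = -m - n := by omega
      simp only [h, if_true]
      push_cast
      module
    · simp only [h, if_false]
      push_cast
      module

instance : LieRing Virasoro where
  bracket x y := bracketAux x.wittPart y.wittPart
  add_lie x y z := by
    change bracketAux (x.wittPart + y.wittPart) _ = _
    rw [map_add]
    rfl
  lie_add x y z := map_add (bracketAux x.wittPart) _ _
  lie_self x := bracketAux_self _
  leibniz_lie x y z := bracketAux_leibniz _ _ _

instance : LieAlgebra ℂ Virasoro where
  lie_smul _ x _ := map_smul (bracketAux x.wittPart) _ _

/-- `[Lₘ, Lₙ] = (m - n) Lₘ₊ₙ + (m³ - m)/12 δ_{m+n,0} C`. -/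
theorem lie_L (m n : ℤ) : ⁅L m, L n⁆ = ((m : ℂ) - n) • L (m + n) +
    (if m + n = 0 then ((m : ℂ) ^ 3 - m) / 12 else 0) • C := by
  have := bracketAux_single m n 1 1
  rwa [one_mul, one_smul] at this

theorem lie_C (x : Virasoro) : ⁅x, C⁆ = 0 := map_zero (bracketAux x.wittPart)

end Virasoro

/-! ### The universal Virasoro Whittaker module -/

/-- The spanning set `{Lₛ, C | s ≥ 1}` of `N_𝓛`. -/
def virGens : Set Virasoro := {x | (∃ n : ℕ, x = Virasoro.L (n + 1)) ∨ x = Virasoro.C}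

/-- The linear functional sending `x` to
`a * (coefficient of L₁) + b * (coefficient of L₂) + c * (coefficient of C)`. -/
def virFunctional (c a b : ℂ) : Virasoro →ₗ[ℂ] ℂ where
  toFun x := a * x.wittPart 1 + b * x.wittPart 2 + c * x.centralPart
  map_add' x y := by
    simp only [Virasoro.wittPart_add, Virasoro.centralPart_add, Finsupp.add_apply]; ring
  map_smul' r x := by
    simp only [Virasoro.wittPart_smul, Virasoro.centralPart_smul, Finsupp.smul_apply, smul_eq_mul,
      RingHom.id_apply]
    ring

theorem virFunctional_L (c a b : ℂ) (n : ℤ) : virFunctional c a b (Virasoro.L n) =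
    a * (if n = 1 then 1 else 0) + b * (if n = 2 then 1 else 0) := by
  simp [virFunctional, Virasoro.wittPart_L, Virasoro.centralPart_L, Finsupp.single_apply]

theorem virFunctional_C (c a b : ℂ) : virFunctional c a b Virasoro.C = c := by
  simp [virFunctional, Virasoro.wittPart_C, Virasoro.centralPart_C]

theorem virGens_lie (c a b : ℂ) : ∀ x ∈ virGens, ∀ y ∈ virGens,
    ⁅x, y⁆ ∈ Submodule.span ℂ virGens ⊓ LinearMap.ker (virFunctional c a b) := by
  have hL (m : ℤ) (hm : 3 ≤ m) : Virasoro.L m ∈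
      Submodule.span ℂ virGens ⊓ LinearMap.ker (virFunctional c a b) := by
    refine ⟨Submodule.subset_span (Or.inl ⟨(m - 1).toNat, ?_⟩), ?_⟩
    · congr; omega
    · have h1 : m ≠ 1 := by omega
      have h2 : m ≠ 2 := by omega
      simp [virFunctional_L, h1, h2]
  rintro x (⟨m, rfl⟩ | rfl) y (⟨n, rfl⟩ | rfl)
  · by_cases hmn : m = n
    · rw [hmn, lie_self]; exact Submodule.zero_mem _
    · have h0 : ¬ ((m : ℤ) + 1 + (n + 1) = 0) := by omega
      rw [Virasoro.lie_L, if_neg h0, zero_smul, add_zero]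
      exact Submodule.smul_mem _ _ (hL _ (by omega))
  · rw [Virasoro.lie_C]; exact Submodule.zero_mem _
  · rw [← lie_skew, Virasoro.lie_C, neg_zero]; exact Submodule.zero_mem _
  · rw [Virasoro.lie_C]; exact Submodule.zero_mem _

/-- The subalgebra `N_𝓛 = ⨁_{s ≥ 1} ℂ Lₛ ⊕ ℂ C`. -/
def virN : LieSubalgebra ℂ Virasoro :=
  spanSubalgebra virGens fun x hx y hy => (virGens_lie 0 0 0 x hx y hy).1

/-- The character of `N_𝓛` with `L₁ ↦ a`, `L₂ ↦ b`, `C ↦ c` and `Lₛ ↦ 0` for `s ≥ 3`. -/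
def virChar (c a b : ℂ) : virN →ₗ⁅ℂ⁆ ℂ :=
  restrictChar virN (virFunctional c a b) fun _ hx _ hy =>
    (lie_mem_of_span (virGens_lie c a b) hx hy).2

/-- The universal Virasoro Whittaker module of central charge `c`. -/
abbrev WhVir (c a b : ℂ) : Type :=
  InducedModule virN (charRep virN (virChar c a b))

/-- The Whittaker vector `1 ⊗ u`. -/
def whVirVec (c a b : ℂ) : WhVir c a b := InducedModule.tmul virN _ 1 1

/-- The image of `Lₙ` in the universal enveloping algebra. -/
def uL (n : ℤ) : UniversalEnvelopingAlgebra ℂ Virasoro :=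
  UniversalEnvelopingAlgebra.ι ℂ (Virasoro.L n)

/-- The vector obtained from `affPBW` by the substitution `eᵢ ↦ L_{3i+1}`, `hᵢ ↦ L_{3i}`,
`fᵢ ↦ L_{3i-1}`, `w ↦ w`: with `k_{i+1} = κ i` it is
`∏_{i ≥ 0} L_{-3i}^{l i} L_{-3i-1}^{m i} L_{-3(i+1)+1}^{k_{i+1}} w`, with factors ordered from left
to right with increasing `i`; in other words the ordered product
`L₀^{l 0} L₋₁^{m 0} L₋₂^{κ 0} L₋₃^{l 1} L₋₄^{m 1} L₋₅^{κ 1} ⋯ w`. -/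
def virPBW (c a b : ℂ) (κ l m : ℕ →₀ ℕ) : WhVir c a b :=
  (((κ.support ∪ l.support ∪ m.support).sort (· ≤ ·)).map fun i : ℕ =>
    uL (-3 * i) ^ l i * uL (-3 * i - 1) ^ m i * uL (-3 * (i + 1) + 1) ^ κ i).prod •
      whVirVec c a b

end WhittakerIso

end

noncomputable section

namespace WhittakerIso

open scoped TensorProduct

attribute [local instance 100] LieRing.ofAssociativeRing

/-! ### The action of a Lie algebra on polynomials in a complement of a subalgebra -/

/-! Both modules are induced from a character `χ` of a subalgebra `H` of `g`. By the relative
Poincaré–Birkhoff–Witt theorem the ordered monomials in any ordered basis of a complement of `H`,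
applied to the generator, form a basis. Here the complements are spanned by e₋ᵢ₋₁, h₋ᵢ, f₋ᵢ and by
the L₋ₛ with s ≥ 0. Both are indexed by `ℕ ×ₗ Fin 3`, where L₋₃ᵢ₋ₜ has index (i, t). So both bases
are indexed by triples of finitely supported exponents, and the map merely matches one basis with
the other. It need not respect the brackets, and the different order of the three letters within a
block only permutes the exponents.

The substance is the Poincaré–Birkhoff–Witt theorem for `H`. The space of polynomials `Multiset I →₀
ℂ` is made into a `g`-module in which `H` acts on 1 by `χ`, and `z i` multiplies a monomial without
variables smaller than `i`. The rest is forced: if `j` is the least variable of z_j N, and x lies in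
`H` or is a later basis vector, then x z_j N = z_j x N + [x, z_j] N (`act_cons`). The Jacobi
identity and induction on degree show that this is a representation (`commutesOn_single`).

Linear independence follows because the ordered product over `N` sends 1 to the monomial `N`
(`envRep_monomial`), while the relations of the induced module are killed (`toPolyAux_eq_zero`). For
spanning, the linear map `ofPoly` from polynomials to the induced module is `g`-equivariant, so its
image is a submodule containing the generator (`span_monomial`). -/

/-- A complement of a Lie subalgebra `H` with ordered basis `z`: every `x` is the sum of
`∑ i, coord x i • z i` and of `proj x ∈ H`. -/
structure OrderedComplement {g : Type*} [LieRing g] [LieAlgebra ℂ g] (H : LieSubalgebra ℂ g)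
    (I : Type*) where
  z : I → g
  coord : g →ₗ[ℂ] I →₀ ℂ
  proj : g →ₗ[ℂ] H
  decomp : ∀ x, Finsupp.linearCombination ℂ z (coord x) + proj x = x
  coord_z : ∀ i, coord (z i) = Finsupp.single i 1
  coord_H : ∀ x ∈ H, coord x = 0

/-! ### Filtration of the polynomials by degree -/

/-- The linear span of the monomials of degree at most `n`. -/
def degLE (I : Type*) (n : ℕ) : Submodule ℂ (Multiset I →₀ ℂ) :=
  Finsupp.supported ℂ ℂ {N | N.card ≤ n}

theorem single_mem_degLE {I : Type*} {n : ℕ} {N : Multiset I} (h : N.card ≤ n) (c : ℂ) :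
    Finsupp.single N c ∈ degLE I n :=
  Finsupp.single_mem_supported ℂ c h

theorem degLE_mono {I : Type*} {m n : ℕ} (h : m ≤ n) : degLE I m ≤ degLE I n :=
  Finsupp.supported_mono fun _ hN => le_trans hN h

theorem eq_of_eqOn_degLE {I V : Type*} [AddCommMonoid V] [Module ℂ V] {n : ℕ}
    {f f' : (Multiset I →₀ ℂ) →ₗ[ℂ] V}
    (h : ∀ N : Multiset I, N.card ≤ n → f (Finsupp.single N 1) = f' (Finsupp.single N 1))
    {v : Multiset I →₀ ℂ} (hv : v ∈ degLE I n) : f v = f' v := by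
  rw [degLE, Finsupp.supported_eq_span_single] at hv
  refine LinearMap.eqOn_span (f := f) (g := f') ?_ hv
  rintro _ ⟨N, hN, rfl⟩
  exact h N hN

/-- Multiplication of the monomial `N` by linear polynomials. -/
def topMul {I : Type*} (N : Multiset I) : (I →₀ ℂ) →ₗ[ℂ] Multiset I →₀ ℂ :=
  Finsupp.lmapDomain ℂ ℂ fun i => i ::ₘ N

theorem topMul_single {I : Type*} (N : Multiset I) (i : I) (c : ℂ) :
    topMul N (Finsupp.single i c) = Finsupp.single (i ::ₘ N) c := by
  simp [topMul]

theorem topMul_mem {I : Type*} (N : Multiset I) (v : I →₀ ℂ) :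
    topMul N v ∈ degLE I (N.card + 1) := by
  induction v using Finsupp.induction_linear with
  | zero => simp
  | add v w hv hw => rw [map_add]; exact add_mem hv hw
  | single i c => rw [topMul_single]; exact single_mem_degLE (by simp) c

/-- Splitting off the least variable is the case distinction behind the inductions on degree below.
-/
theorem eq_zero_or_exists_cons {I : Type*} [LinearOrder I] (N : Multiset I) :
    N = 0 ∨ ∃ j N', N = j ::ₘ N' ∧ ∀ a ∈ N', j ≤ a := by
  have hs := N.pairwise_sort (· ≤ ·)
  have he := N.sort_eq (· ≤ ·)
  rcases hN : N.sort (· ≤ ·) with _ | ⟨j, t⟩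
  · left; rw [← he, hN]; rfl
  · right
    rw [hN] at hs he
    exact ⟨j, t, by rw [← he]; rfl, fun a ha => (List.pairwise_cons.1 hs).1 a ha⟩

namespace OrderedComplement

variable {g : Type*} [LieRing g] [LieAlgebra ℂ g] {H : LieSubalgebra ℂ g} {I : Type*}
  (O : OrderedComplement H I)

theorem proj_z (i : I) : O.proj (O.z i) = 0 := by
  have := O.decomp (O.z i)
  rw [O.coord_z, Finsupp.linearCombination_single, one_smul] at this
  simpa using this

theorem proj_H (x : H) : O.proj x = x := by
  have := O.decomp x
  rw [O.coord_H _ x.2, map_zero, zero_add] at this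
  exact Subtype.ext this

theorem induction {p : g → Prop} (add : ∀ x y, p x → p y → p (x + y))
    (smul : ∀ (c : ℂ) x, p x → p (c • x)) (hz : ∀ i, p (O.z i)) (hH : ∀ x ∈ H, p x) (x : g) :
    p x := by
  rw [← O.decomp x]
  refine add _ _ ?_ (hH _ (O.proj x).2)
  induction O.coord x using Finsupp.induction_linear with
  | zero => simpa using hH 0 H.zero_mem
  | add v w hv hw => rw [map_add]; exact add _ _ hv hw
  | single i c => rw [Finsupp.linearCombination_single]; exact smul _ _ (hz i)

variable [LinearOrder I] (χ : H →ₗ⁅ℂ⁆ ℂ)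

/-! ### Recursive construction of the action -/

/-- The rewriting rule for the action of `x` on a monomial whose least variable has to be moved
to the left of `x`. -/
def rewriteStep (A : (Multiset I →₀ ℂ) →ₗ[ℂ] g →ₗ[ℂ] Multiset I →₀ ℂ) :
    List I → g →ₗ[ℂ] Multiset I →₀ ℂ
  | [] => (χ.toLinearMap ∘ₗ O.proj).smulRight (Finsupp.single 0 1)
  | j :: t =>
      -- This is x z_j t = z_j (x t) - [z_j, x] t, with z_j (x t) split in two. The leading part of
      -- x t has degree `t.length + 1`, where `A` need not be correct yet, so its product with z_j
      -- is written down directly; `A` is applied only to the remainder, of lower degree.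
      (Finsupp.lmapDomain ℂ ℂ fun i => j ::ₘ i ::ₘ (t : Multiset I)) ∘ₗ O.coord +
      A.flip (O.z j) ∘ₗ (A (Finsupp.single t 1) - topMul t ∘ₗ O.coord) -
      A (Finsupp.single t 1) ∘ₗ LieAlgebra.ad ℂ g (O.z j)

/-- The value on monomials of an approximation to the action, in terms of the preceding one. -/
def actStep (A : (Multiset I →₀ ℂ) →ₗ[ℂ] g →ₗ[ℂ] Multiset I →₀ ℂ) (N : Multiset I) :
    g →ₗ[ℂ] Multiset I →₀ ℂ :=
  -- A variable that is at most all those of `N` multiplies `N`. The condition is vacuous for `N =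
  -- 0`, so on 1 the rewriting rule only concerns `H`.
  Finsupp.linearCombination ℂ (fun i => if ∀ a ∈ N, i ≤ a then Finsupp.single (i ::ₘ N) 1
    else O.rewriteStep χ A (N.sort (· ≤ ·)) (O.z i)) ∘ₗ O.coord +
  O.rewriteStep χ A (N.sort (· ≤ ·)) ∘ₗ H.toSubmodule.subtype ∘ₗ O.proj

/-- An approximation to the action, correct on monomials of degree less than `n`. -/
def actApprox : ℕ → (Multiset I →₀ ℂ) →ₗ[ℂ] g →ₗ[ℂ] Multiset I →₀ ℂ
  | 0 => 0
  | n + 1 => Finsupp.linearCombination ℂ (O.actStep χ (actApprox n))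

/-- The action of a Lie algebra on polynomials in a complement of a subalgebra `H` for which `H`
acts on `1` by the character `χ`. The vector is the first argument. -/
def act : (Multiset I →₀ ℂ) →ₗ[ℂ] g →ₗ[ℂ] Multiset I →₀ ℂ :=
  Finsupp.linearCombination ℂ fun N => O.actApprox χ (N.card + 1) (Finsupp.single N 1)

theorem actApprox_succ_single (n : ℕ) (N : Multiset I) :
    O.actApprox χ (n + 1) (Finsupp.single N 1) = O.actStep χ (O.actApprox χ n) N := by
  simp [actApprox]

theorem act_single (N : Multiset I) :
    O.act χ (Finsupp.single N 1) = O.actApprox χ (N.card + 1) (Finsupp.single N 1) := by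
  simp [act]

theorem actStep_z_of_le (A : (Multiset I →₀ ℂ) →ₗ[ℂ] g →ₗ[ℂ] Multiset I →₀ ℂ) {i : I}
    {N : Multiset I} (h : ∀ a ∈ N, i ≤ a) :
    O.actStep χ A N (O.z i) = Finsupp.single (i ::ₘ N) 1 := by
  simp [actStep, O.coord_z, O.proj_z, if_pos h]

theorem actStep_of_mem (A : (Multiset I →₀ ℂ) →ₗ[ℂ] g →ₗ[ℂ] Multiset I →₀ ℂ)
    (N : Multiset I) {x : g} (hx : x ∈ H) :
    O.actStep χ A N x = O.rewriteStep χ A (N.sort (· ≤ ·)) x := by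
  have := O.proj_H ⟨x, hx⟩
  simp only at this
  simp [actStep, O.coord_H x hx, this]

theorem actStep_z_of_lt (A : (Multiset I →₀ ℂ) →ₗ[ℂ] g →ₗ[ℂ] Multiset I →₀ ℂ) {i j : I}
    (N : Multiset I) (h : j < i) :
    O.actStep χ A (j ::ₘ N) (O.z i) = O.rewriteStep χ A ((j ::ₘ N).sort (· ≤ ·)) (O.z i) := by
  have : ¬ ∀ a ∈ j ::ₘ N, i ≤ a := fun h' => not_lt_of_ge (h' j (Multiset.mem_cons_self j N)) h
  simp [actStep, O.coord_z, O.proj_z, if_neg this, -Multiset.mem_cons]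

/-- `x` lies in `H` or is a basis vector that comes after `z j`. -/
def After (j : I) (x : g) : Prop := x ∈ H ∨ ∃ i, j < i ∧ x = O.z i

/-- The rewriting rule starts with the least variable, which is `j`, and it applies alike to
elements of `H` and to later basis vectors; this is why `After` treats the two together. -/
theorem actStep_cons (A : (Multiset I →₀ ℂ) →ₗ[ℂ] g →ₗ[ℂ] Multiset I →₀ ℂ) {j : I}
    {N : Multiset I} (hj : ∀ a ∈ N, j ≤ a) {x : g} (hx : O.After j x) :
    O.actStep χ A (j ::ₘ N) x =
      Finsupp.lmapDomain ℂ ℂ (fun i => j ::ₘ i ::ₘ N) (O.coord x) +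
      A (A (Finsupp.single N 1) x - topMul N (O.coord x)) (O.z j) +
      A (Finsupp.single N 1) ⁅x, O.z j⁆ := by
  have key : O.actStep χ A (j ::ₘ N) x =
      O.rewriteStep χ A ((j ::ₘ N).sort (· ≤ ·)) x := by
    rcases hx with hx | ⟨i, hi, rfl⟩
    · exact O.actStep_of_mem χ A _ hx
    · exact O.actStep_z_of_lt χ A N hi
  rw [key, Multiset.sort_cons j N (· ≤ ·) hj, rewriteStep, Multiset.sort_eq, ← lie_skew x (O.z j), map_neg]
  simp [sub_eq_add_neg]

/-- The three claims need each other: the recursion evaluates the action on the remainder of x N',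
and only the degree bound for that remainder ensures that the approximations are already stable
there. All are proved by one strong induction on degree. -/
theorem act_single_aux (N : Multiset I) :
    (∀ n, N.card < n → O.actApprox χ n (Finsupp.single N 1) = O.act χ (Finsupp.single N 1)) ∧
    O.act χ (Finsupp.single N 1) = O.actStep χ (O.act χ) N ∧
    ∀ x, O.act χ (Finsupp.single N 1) x - topMul N (O.coord x) ∈ degLE I N.card := by
  induction hk : N.card using Nat.strong_induction_on generalizing N with
  | _ k ih =>
  subst hk
  have ext_deg {n m : ℕ} (hn : m < N.card) (hnm : m < n) {v : Multiset I →₀ ℂ}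
      (hv : v ∈ degLE I m) : O.actApprox χ n v = O.act χ v :=
    eq_of_eqOn_degLE (f := O.actApprox χ n) (f' := O.act χ) (fun N' hN' =>
      (ih _ (lt_of_le_of_lt hN' hn) N' rfl).1 n (lt_of_le_of_lt hN' hnm)) hv
  have act_mem {m : ℕ} (hn : m < N.card) {v : Multiset I →₀ ℂ} (hv : v ∈ degLE I m) (x : g) :
      O.act χ v x ∈ degLE I (m + 1) := by
    have : degLE I m ≤ (degLE I (m + 1)).comap ((O.act χ).flip x) := by
      rw [degLE, Finsupp.supported_eq_span_single, Submodule.span_le]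
      rintro _ ⟨N', hN', rfl⟩
      change O.act χ (Finsupp.single N' 1) x ∈ degLE I (m + 1)
      have hN'' : N'.card ≤ m := hN'
      have h1 := (ih _ (lt_of_le_of_lt hN'' hn) N' rfl).2.2 x
      have h2 := topMul_mem N' (O.coord x)
      have := add_mem (degLE_mono (by omega : N'.card ≤ m + 1) h1)
        (degLE_mono (by omega : N'.card + 1 ≤ m + 1) h2)
      rwa [sub_add_cancel] at this
    exact this hv
  -- For `N = j ::ₘ N'` the step uses its argument only on `N'` and on a remainder of degree at most
  -- `N'.card < n`, where the approximation agrees with `act`. For `N = 0` it does not use its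
  -- argument at all.
  have stable : ∀ n, N.card < n + 1 →
      O.actStep χ (O.actApprox χ n) N = O.actStep χ (O.act χ) N := by
    intro n hn
    rcases eq_zero_or_exists_cons N with rfl | ⟨j, N', rfl, hj⟩
    · simp [actStep, rewriteStep]
    · rw [Multiset.card_cons] at *
      have hN' := ih _ (Nat.lt_succ_self _) N' rfl
      have hr : ∀ x, O.After j x → O.actStep χ (O.actApprox χ n) (j ::ₘ N') x =
          O.actStep χ (O.act χ) (j ::ₘ N') x := by
        intro x hx
        rw [O.actStep_cons χ _ hj hx, O.actStep_cons χ _ hj hx, hN'.1 n (by omega),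
          ext_deg (Nat.lt_succ_self _) (by omega) (hN'.2.2 x)]
      ext x
      refine DFunLike.congr_fun ?_ _
      induction x using O.induction with
      | add x y hx hy => rw [map_add, map_add, hx, hy]
      | smul c x hx => rw [map_smul, map_smul, hx]
      | hH x hx => exact hr x (Or.inl hx)
      | hz i =>
        rcases le_or_gt i j with hij | hij
        · have : ∀ a ∈ j ::ₘ N', i ≤ a := by
            intro a ha
            rcases Multiset.mem_cons.1 ha with rfl | ha
            · exact hij
            · exact hij.trans (hj a ha)
          rw [O.actStep_z_of_le χ _ this, O.actStep_z_of_le χ _ this]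
        · exact hr _ (Or.inr ⟨i, hij, rfl⟩)
  have fix : O.act χ (Finsupp.single N 1) = O.actStep χ (O.act χ) N := by
    rw [act_single, actApprox_succ_single, stable _ (Nat.lt_succ_self _)]
  refine ⟨fun n hn => ?_, fix, fun x => ?_⟩
  · obtain ⟨n, rfl⟩ := Nat.exists_eq_succ_of_ne_zero (by omega : n ≠ 0)
    rw [Nat.succ_eq_add_one, actApprox_succ_single, stable n hn, fix]
  · have hr : ∀ j N', N = j ::ₘ N' → (∀ a ∈ N', j ≤ a) → ∀ x, O.After j x →
        O.act χ (Finsupp.single N 1) x - topMul N (O.coord x) ∈ degLE I N.card := by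
      rintro j N' rfl hj x hx
      rw [Multiset.card_cons] at *
      have hN' := (ih _ (Nat.lt_succ_self _) N' rfl).2.2 x
      rw [fix, O.actStep_cons χ _ hj hx]
      have h1 : Finsupp.lmapDomain ℂ ℂ (fun i => j ::ₘ i ::ₘ N') (O.coord x) =
          topMul (j ::ₘ N') (O.coord x) := by
        simp only [topMul, Multiset.cons_swap j]
      rw [h1, add_assoc, add_sub_cancel_left]
      -- Once the leading term has cancelled, z_j acts on a remainder of degree at most `N'.card`
      -- and the bracket acts on `N'`; either raises the degree by at most one.
      exact add_mem (act_mem (Nat.lt_succ_self _) hN' _)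
        (act_mem (Nat.lt_succ_self _) (single_mem_degLE le_rfl 1) _)
    induction x using O.induction with
    | add x y hx hy =>
      rw [map_add, map_add, map_add, add_sub_add_comm]
      exact add_mem hx hy
    | smul c x hx =>
      rw [map_smul, map_smul, map_smul, ← smul_sub]
      exact Submodule.smul_mem _ c hx
    | hz i =>
      by_cases hi : ∀ a ∈ N, i ≤ a
      · rw [fix, O.actStep_z_of_le χ _ hi, O.coord_z, topMul_single, sub_self]
        exact zero_mem _
      · rcases eq_zero_or_exists_cons N with rfl | ⟨j, N', rfl, hj⟩
        · simp at hi
        · refine hr j N' rfl hj _ (Or.inr ⟨i, ?_, rfl⟩)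
          by_contra hij
          refine hi fun a ha => ?_
          rcases Multiset.mem_cons.1 ha with rfl | ha
          · exact not_lt.1 hij
          · exact (not_lt.1 hij).trans (hj a ha)
    | hH x hx =>
      rcases eq_zero_or_exists_cons N with rfl | ⟨j, N', rfl, hj⟩
      · rw [fix, O.actStep_of_mem χ _ _ hx, O.coord_H x hx, map_zero, sub_zero, Multiset.sort_zero]
        exact Submodule.smul_mem _ _ (single_mem_degLE le_rfl 1)
      · exact hr j N' rfl hj x (Or.inl hx)

theorem act_z_of_le {i : I} {N : Multiset I} (h : ∀ a ∈ N, i ≤ a) :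
    O.act χ (Finsupp.single N 1) (O.z i) = Finsupp.single (i ::ₘ N) 1 := by
  rw [(O.act_single_aux χ N).2.1, O.actStep_z_of_le χ _ h]

theorem act_zero_of_mem {x : g} (hx : x ∈ H) :
    O.act χ (Finsupp.single 0 1) x = χ ⟨x, hx⟩ • Finsupp.single 0 1 := by
  have := O.proj_H ⟨x, hx⟩
  simp only at this
  rw [(O.act_single_aux χ 0).2.1, O.actStep_of_mem χ _ _ hx, Multiset.sort_zero, rewriteStep]
  simp [this]

theorem act_sub_topMul_mem (N : Multiset I) (x : g) :
    O.act χ (Finsupp.single N 1) x - topMul N (O.coord x) ∈ degLE I N.card :=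
  (O.act_single_aux χ N).2.2 x

/-- The term inserted by hand in the recursion is the true value of `z j` on the leading part of x
N: that part vanishes for x in `H`, and otherwise `j` is at most each of its variables. -/
theorem act_cons {j : I} {N : Multiset I} (hj : ∀ a ∈ N, j ≤ a) {x : g} (hx : O.After j x) :
    O.act χ (Finsupp.single (j ::ₘ N) 1) x =
      O.act χ (O.act χ (Finsupp.single N 1) x) (O.z j) + O.act χ (Finsupp.single N 1) ⁅x, O.z j⁆ := by
  rw [(O.act_single_aux χ _).2.1, O.actStep_cons χ _ hj hx, map_sub, LinearMap.sub_apply]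
  congr 1
  rw [add_sub_left_comm, add_eq_left, sub_eq_zero]
  rcases hx with hx | ⟨i, hi, rfl⟩
  · rw [O.coord_H x hx]; simp
  · rw [O.coord_z, topMul_single, O.act_z_of_le χ, Finsupp.lmapDomain_apply,
      Finsupp.mapDomain_single]
    intro a ha
    rcases Multiset.mem_cons.1 ha with rfl | ha
    · exact hi.le
    · exact hj a ha

/-! ### The commutation relations -/

/-- The operators of `x` and `y` on `v` satisfy the commutation relation. -/
def CommutesOn (x y : g) (v : Multiset I →₀ ℂ) : Prop :=
  O.act χ (O.act χ v y) x - O.act χ (O.act χ v x) y = O.act χ v ⁅x, y⁆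

variable {O χ}

theorem CommutesOn.symm {x y : g} {v : Multiset I →₀ ℂ} (h : O.CommutesOn χ x y v) :
    O.CommutesOn χ y x v := by
  rw [CommutesOn, ← lie_skew, map_neg, ← h, neg_sub]

theorem CommutesOn.add {x y : g} {v w : Multiset I →₀ ℂ} (h : O.CommutesOn χ x y v)
    (h' : O.CommutesOn χ x y w) : O.CommutesOn χ x y (v + w) := by
  simp only [CommutesOn, map_add, LinearMap.add_apply] at *
  rw [← h, ← h']; abel

theorem CommutesOn.of_self (x : g) (v : Multiset I →₀ ℂ) : O.CommutesOn χ x x v := by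
  rw [CommutesOn, sub_self, lie_self, map_zero]

variable (O χ)

theorem commutesOn_induction {v : Multiset I →₀ ℂ} (y : g) (hz : ∀ i, O.CommutesOn χ (O.z i) y v)
    (hH : ∀ x ∈ H, O.CommutesOn χ x y v) (x : g) : O.CommutesOn χ x y v := by
  induction x using O.induction with
  | add x x' h h' =>
    simp only [CommutesOn, map_add, LinearMap.add_apply, add_lie] at *
    rw [← h, ← h']; abel
  | smul c x h =>
    simp only [CommutesOn, map_smul, LinearMap.smul_apply, smul_lie] at *
    rw [← h, smul_sub]
  | hz i => exact hz i
  | hH x hx => exact hH x hx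

/-- Here `z j` multiplies `N`, and the relation becomes the recursion `act_cons`. -/
theorem commutesOn_of_le {j : I} {N : Multiset I} (hj : ∀ a ∈ N, j ≤ a) {x : g}
    (hx : O.After j x) : O.CommutesOn χ x (O.z j) (Finsupp.single N 1) := by
  rw [CommutesOn, O.act_z_of_le χ hj, O.act_cons χ hj hx, add_sub_cancel_left]

/-- Write the monomial as z_k N and move z_k to the left past x and y. What remains are relations on
`N`, known by induction, for (x, [y, z_k]), (y, [x, z_k]), (x, y) and ([x, y], z_k); the Jacobi
identity for [[x, y], z_k] makes them add up. -/
theorem commutesOn_cons {k : I} {N : Multiset I} (hk : ∀ a ∈ N, k ≤ a)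
    (ih : ∀ v ∈ degLE I N.card, ∀ x y, O.CommutesOn χ x y v) {x y : g}
    (hx : O.After k x) (hy : O.After k y) :
    O.CommutesOn χ x y (Finsupp.single (k ::ₘ N) 1) := by
  -- The vector y N may have degree `N.card + 1`, beyond the induction hypothesis. Its leading part
  -- is zero or a monomial with no variable below `k`, so `commutesOn_of_le` covers it.
  have comm (x y : g) (hx : O.After k x) (hy : O.After k y) :
      O.CommutesOn χ x (O.z k) (O.act χ (Finsupp.single N 1) y) := by
    rw [← sub_add_cancel (O.act χ (Finsupp.single N 1) y) (topMul N (O.coord y))]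
    refine (ih _ (O.act_sub_topMul_mem χ N y) _ _).add ?_
    rcases hy with hy | ⟨j, hj, rfl⟩
    · rw [O.coord_H y hy, map_zero]; simp [CommutesOn]
    · rw [O.coord_z, topMul_single]
      refine O.commutesOn_of_le χ ?_ hx
      intro a ha
      rcases Multiset.mem_cons.1 ha with rfl | ha
      · exact hj.le
      · exact hk a ha
  have hN := ih _ (single_mem_degLE (I := I) le_rfl 1)
  have e1 := comm x y hx hy
  have e2 := comm y x hy hx
  have e3 := hN x ⁅y, O.z k⁆
  have e4 := hN y ⁅x, O.z k⁆
  have e5 := hN x y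
  have e6 := hN ⁅x, y⁆ (O.z k)
  have e7 := O.act_z_of_le χ hk
  have e8 : ⁅⁅x, y⁆, O.z k⁆ = ⁅x, ⁅y, O.z k⁆⁆ - ⁅y, ⁅x, O.z k⁆⁆ := by rw [lie_lie]
  simp only [CommutesOn] at *
  rw [O.act_cons χ hk hx, O.act_cons χ hk hy, ← e7]
  rw [e8, map_sub, ← e3, ← e4, ← e5, map_sub, LinearMap.sub_apply] at e6
  rw [sub_eq_iff_eq_add] at e1 e2 e6
  simp only [map_add, LinearMap.add_apply]
  rw [e1, e2]
  rw [e6]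
  abel

theorem commutesOn_single (N : Multiset I) (x y : g) :
    O.CommutesOn χ x y (Finsupp.single N 1) := by
  induction hk : N.card using Nat.strong_induction_on generalizing N x y with
  | _ k ih =>
  subst hk
  have hgen (x y : g) (hx : x ∈ H ∨ ∃ i, x = O.z i) (hy : y ∈ H ∨ ∃ i, y = O.z i) :
      O.CommutesOn χ x y (Finsupp.single N 1) := by
    rcases eq_zero_or_exists_cons N with rfl | ⟨k, N, rfl, hk⟩
    · have hle (i : I) : ∀ a ∈ (0 : Multiset I), i ≤ a := by simp
      rcases hx with hx | ⟨i, rfl⟩ <;> rcases hy with hy | ⟨j, rfl⟩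
      -- On 1 two elements of `H` act by scalars, and `χ` vanishes on their bracket.
      · have h := χ.map_lie ⟨x, hx⟩ ⟨y, hy⟩
        have hxy : χ ⟨⁅x, y⁆, H.lie_mem hx hy⟩ = 0 := by
          rw [LieRing.of_associative_ring_bracket, mul_comm, sub_self] at h
          exact h
        rw [CommutesOn, O.act_zero_of_mem χ (H.lie_mem hx hy), hxy, O.act_zero_of_mem χ hx,
          O.act_zero_of_mem χ hy, map_smul, map_smul, LinearMap.smul_apply, LinearMap.smul_apply,
          O.act_zero_of_mem χ hx, O.act_zero_of_mem χ hy, smul_smul, smul_smul, mul_comm, sub_self,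
          zero_smul]
      · exact O.commutesOn_of_le χ (hle j) (Or.inl hx)
      · exact (O.commutesOn_of_le χ (hle i) (Or.inl hy)).symm
      · rcases lt_trichotomy i j with h | rfl | h
        · exact (O.commutesOn_of_le χ (hle i) (Or.inr ⟨j, h, rfl⟩)).symm
        · exact .of_self _ _
        · exact O.commutesOn_of_le χ (hle j) (Or.inr ⟨i, h, rfl⟩)
    · have hle (i : I) (hi : i ≤ k) : ∀ a ∈ k ::ₘ N, i ≤ a := by
        intro a ha
        rcases Multiset.mem_cons.1 ha with rfl | ha
        · exact hi
        · exact hi.trans (hk a ha)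
      have hlow (x y : g) (v) (hv : v ∈ degLE I N.card) : O.CommutesOn χ x y v := by
        rw [CommutesOn]
        refine eq_of_eqOn_degLE
          (f := (O.act χ).flip x ∘ₗ (O.act χ).flip y - (O.act χ).flip y ∘ₗ (O.act χ).flip x)
          (f' := (O.act χ).flip ⁅x, y⁆) (fun N' hN' => ?_) hv
        exact ih _ (by rw [Multiset.card_cons]; omega) N' x y rfl
      have hafter (x y : g) (hx : O.After k x) (hy : O.After k y) :=
        O.commutesOn_cons χ hk (fun v hv x y => hlow x y v hv) hx hy
      have hcase (x : g) (hx : x ∈ H ∨ ∃ i, x = O.z i) :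
          O.After k x ∨ ∃ i, i ≤ k ∧ x = O.z i := by
        rcases hx with hx | ⟨i, rfl⟩
        · exact Or.inl (Or.inl hx)
        · rcases le_or_gt i k with h | h
          · exact Or.inr ⟨i, h, rfl⟩
          · exact Or.inl (Or.inr ⟨i, h, rfl⟩)
      have hmono (x : g) (i : I) (hi : i ≤ k) (hx : O.After k x) : O.After i x := by
        rcases hx with hx | ⟨j, hj, rfl⟩
        · exact Or.inl hx
        · exact Or.inr ⟨j, hi.trans_lt hj, rfl⟩
      -- If both elements come after `k`, the Jacobi argument applies. Otherwise one of them is a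
      -- basis vector with index at most `k`, and the one with the smallest index multiplies the
      -- monomial.
      rcases hcase x hx with hx | ⟨i, hi, rfl⟩ <;> rcases hcase y hy with hy | ⟨j, hj, rfl⟩
      · exact hafter x y hx hy
      · exact O.commutesOn_of_le χ (hle j hj) (hmono x j hj hx)
      · exact (O.commutesOn_of_le χ (hle i hi) (hmono y i hi hy)).symm
      · rcases lt_trichotomy i j with h | rfl | h
        · exact (O.commutesOn_of_le χ (hle i hi) (Or.inr ⟨j, h, rfl⟩)).symm
        · exact .of_self _ _
        · exact O.commutesOn_of_le χ (hle j hj) (Or.inr ⟨i, h, rfl⟩)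
  have hleft (y : g) (hy : y ∈ H ∨ ∃ i, y = O.z i) (x : g) :
      O.CommutesOn χ x y (Finsupp.single N 1) :=
    O.commutesOn_induction χ y (fun i => hgen _ _ (Or.inr ⟨i, rfl⟩) hy)
      (fun x hx => hgen _ _ (Or.inl hx) hy) x
  exact (O.commutesOn_induction χ x (fun i => (hleft _ (Or.inr ⟨i, rfl⟩) x).symm)
    (fun y hy => (hleft _ (Or.inl hy) x).symm) y).symm

/-- The representation of `g` on polynomials in a complement of `H`. -/
def rep : g →ₗ⁅ℂ⁆ Module.End ℂ (Multiset I →₀ ℂ) where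
  toLinearMap := (O.act χ).flip
  map_lie' {x y} := by
    refine Finsupp.lhom_ext' fun N => LinearMap.ext_ring ?_
    exact Eq.symm (O.commutesOn_single χ N x y)

theorem rep_apply (x : g) (v : Multiset I →₀ ℂ) : O.rep χ x v = O.act χ v x := rfl

end OrderedComplement

/-! ### The Poincaré–Birkhoff–Witt basis of a module induced from a character -/

/-- The elements satisfying `p` form a subalgebra `S` containing the image of `g`. By the universal
property the lift to `S`, followed by the inclusion, is the identity, so `S` is everything. -/
theorem enveloping_induction {g : Type*} [LieRing g] [LieAlgebra ℂ g]
    {p : UniversalEnvelopingAlgebra ℂ g → Prop}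
    (algebraMap : ∀ c : ℂ, p (algebraMap ℂ _ c))
    (ι : ∀ x, p (UniversalEnvelopingAlgebra.ι ℂ x))
    (mul : ∀ u v, p u → p v → p (u * v)) (add : ∀ u v, p u → p v → p (u + v))
    (u : UniversalEnvelopingAlgebra ℂ g) : p u := by
  let S : Subalgebra ℂ (UniversalEnvelopingAlgebra ℂ g) :=
    { carrier := {u | p u}
      mul_mem' := fun ha hb => mul _ _ ha hb
      add_mem' := fun ha hb => add _ _ ha hb
      algebraMap_mem' := algebraMap }
  let f : g →ₗ⁅ℂ⁆ S :=
    { toFun := fun x => ⟨UniversalEnvelopingAlgebra.ι ℂ x, ι x⟩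
      map_add' := fun x y => Subtype.ext (map_add _ x y)
      map_smul' := fun c x => Subtype.ext (map_smul _ c x)
      map_lie' := fun {x y} => Subtype.ext (LieHom.map_lie _ x y) }
  have h : S.val.comp (UniversalEnvelopingAlgebra.lift ℂ f) = AlgHom.id ℂ _ := by
    ext x
    simp [f]
  have h' := DFunLike.congr_fun h u
  rw [AlgHom.comp_apply, AlgHom.id_apply] at h'
  rw [← h']
  exact (UniversalEnvelopingAlgebra.lift ℂ f u).2

namespace OrderedComplement

variable {g : Type*} [LieRing g] [LieAlgebra ℂ g] {H : LieSubalgebra ℂ g} {I : Type*}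
  (O : OrderedComplement H I) [LinearOrder I] (χ : H →ₗ⁅ℂ⁆ ℂ)

/-- The ordered product of the basis vectors `z i` over a multiset of indices. -/
def monomial (N : Multiset I) : UniversalEnvelopingAlgebra ℂ g :=
  ((N.sort (· ≤ ·)).map fun i => UniversalEnvelopingAlgebra.ι ℂ (O.z i)).prod

theorem monomial_zero : O.monomial 0 = 1 := by
  rw [monomial, Multiset.sort_zero, List.map_nil, List.prod_nil]

theorem monomial_cons {i : I} {N : Multiset I} (h : ∀ a ∈ N, i ≤ a) :
    O.monomial (i ::ₘ N) = UniversalEnvelopingAlgebra.ι ℂ (O.z i) * O.monomial N := by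
  rw [monomial, Multiset.sort_cons i N (· ≤ ·) h, List.map_cons, List.prod_cons, monomial]

/-- The generator `1 ⊗ 1` of an induced module. -/
def gen : InducedModule H (charRep H χ) := InducedModule.tmul H _ 1 1

theorem tmul_eq (u : UniversalEnvelopingAlgebra ℂ g) (c : ℂ) :
    InducedModule.tmul H (charRep H χ) u c = (c • u) • gen χ := by
  rw [gen, InducedModule.tmul, InducedModule.tmul, ← map_smul, TensorProduct.smul_tmul',
    smul_eq_mul, mul_one, TensorProduct.smul_tmul, smul_eq_mul, mul_one]

theorem ι_smul_gen (x : H) :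
    UniversalEnvelopingAlgebra.ι ℂ (x : g) • gen χ = χ x • gen χ := by
  -- The defining relation with u = 1, b = ι x, v = 1.
  have h : InducedModule.tmul H (charRep H χ)
      (1 * envelopingIncl H (UniversalEnvelopingAlgebra.ι ℂ x)) 1 =
      InducedModule.tmul H (charRep H χ) 1
        (UniversalEnvelopingAlgebra.lift ℂ (charRep H χ) (UniversalEnvelopingAlgebra.ι ℂ x) 1) := by
    rw [InducedModule.tmul, InducedModule.tmul, ← sub_eq_zero, ← map_sub]
    exact (Submodule.Quotient.mk_eq_zero _).2 (Submodule.subset_span ⟨1, _, 1, rfl⟩)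
  rw [tmul_eq, tmul_eq, one_mul, one_smul, UniversalEnvelopingAlgebra.lift_ι_apply,
    envelopingIncl, UniversalEnvelopingAlgebra.lift_ι_apply] at h
  have h1 : charRep H χ x 1 = χ x := by simp [charRep]
  rw [h1, smul_assoc, one_smul] at h
  exact h

/-! ### Spanning by ordered monomials -/

/-- The linear map from polynomials to the induced module given by ordered products. -/
def ofPoly : (Multiset I →₀ ℂ) →ₗ[ℂ] InducedModule H (charRep H χ) :=
  Finsupp.linearCombination ℂ fun N => O.monomial N • gen χ

theorem ofPoly_single (N : Multiset I) :
    O.ofPoly χ (Finsupp.single N 1) = O.monomial N • gen χ := by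
  simp [ofPoly]

theorem ofPoly_act_z {i : I} {N : Multiset I} (h : ∀ a ∈ N, i ≤ a) :
    O.ofPoly χ (O.act χ (Finsupp.single N 1) (O.z i)) =
      UniversalEnvelopingAlgebra.ι ℂ (O.z i) • O.ofPoly χ (Finsupp.single N 1) := by
  rw [O.act_z_of_le χ h, ofPoly_single, ofPoly_single, O.monomial_cons h, mul_smul]

/-- In the enveloping algebra x z_j = z_j x + [x, z_j], which is the recursion defining the action.
Hence the induction on degree, with the leading part treated separately, carries over. -/
theorem ofPoly_act_single (N : Multiset I) (x : g) :
    O.ofPoly χ (O.act χ (Finsupp.single N 1) x) =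
      UniversalEnvelopingAlgebra.ι ℂ x • O.ofPoly χ (Finsupp.single N 1) := by
  induction hk : N.card using Nat.strong_induction_on generalizing N x with
  | _ k ih =>
  subst hk
  have hcons : ∀ j N', N = j ::ₘ N' → (∀ a ∈ N', j ≤ a) → ∀ x, O.After j x →
      O.ofPoly χ (O.act χ (Finsupp.single N 1) x) =
      UniversalEnvelopingAlgebra.ι ℂ x • O.ofPoly χ (Finsupp.single N 1) := by
    rintro j N' rfl hj x hx
    rw [Multiset.card_cons] at ih
    have hlow (v : Multiset I →₀ ℂ) (hv : v ∈ degLE I N'.card) : O.ofPoly χ (O.act χ v (O.z j)) =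
        UniversalEnvelopingAlgebra.ι ℂ (O.z j) • O.ofPoly χ v := by
      refine eq_of_eqOn_degLE (f := O.ofPoly χ ∘ₗ (O.act χ).flip (O.z j))
        (f' := Algebra.lsmul ℂ ℂ _ (UniversalEnvelopingAlgebra.ι ℂ (O.z j)) ∘ₗ O.ofPoly χ)
        (fun N'' hN'' => ?_) hv
      exact ih _ (Nat.lt_succ_of_le hN'') N'' _ rfl
    have h1 : O.ofPoly χ (O.act χ (O.act χ (Finsupp.single N' 1) x) (O.z j)) =
        UniversalEnvelopingAlgebra.ι ℂ (O.z j) •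
          O.ofPoly χ (O.act χ (Finsupp.single N' 1) x) := by
      rw [← sub_add_cancel (O.act χ (Finsupp.single N' 1) x) (topMul N' (O.coord x))]
      simp only [map_add, LinearMap.add_apply, smul_add]
      congr 1
      · exact hlow _ (O.act_sub_topMul_mem χ N' x)
      · rcases hx with hx | ⟨i, hi, rfl⟩
        · rw [O.coord_H x hx]; simp
        · rw [O.coord_z, topMul_single]
          refine O.ofPoly_act_z χ fun a ha => ?_
          rcases Multiset.mem_cons.1 ha with rfl | ha
          · exact hi.le
          · exact hj a ha
    rw [O.act_cons χ hj hx, map_add, h1, ih _ (Nat.lt_succ_self _) N' _ rfl,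
      ih _ (Nat.lt_succ_self _) N' _ rfl, ofPoly_single, ofPoly_single, O.monomial_cons hj,
      LieHom.map_lie, LieRing.of_associative_ring_bracket]
    simp only [← mul_smul, ← add_smul]
    congr 1
    noncomm_ring
  induction x using O.induction with
  | add x y hx hy => rw [map_add, map_add, map_add, add_smul, hx, hy]
  | smul c x hx => rw [map_smul, map_smul, map_smul, smul_assoc, hx]
  | hz i =>
    rcases eq_zero_or_exists_cons N with rfl | ⟨j, N', rfl, hj⟩
    · exact O.ofPoly_act_z χ (by simp)
    · rcases le_or_gt i j with h | h
      · refine O.ofPoly_act_z χ fun a ha => ?_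
        rcases Multiset.mem_cons.1 ha with rfl | ha
        · exact h
        · exact h.trans (hj a ha)
      · exact hcons j N' rfl hj _ (Or.inr ⟨i, h, rfl⟩)
  | hH x hx =>
    rcases eq_zero_or_exists_cons N with rfl | ⟨j, N', rfl, hj⟩
    · rw [O.act_zero_of_mem χ hx, map_smul, ofPoly_single, monomial_zero, one_smul]
      exact (ι_smul_gen χ ⟨x, hx⟩).symm
    · exact hcons j N' rfl hj _ (Or.inl hx)

theorem ofPoly_act (v : Multiset I →₀ ℂ) (x : g) :
    O.ofPoly χ (O.act χ v x) = UniversalEnvelopingAlgebra.ι ℂ x • O.ofPoly χ v := by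
  induction v using Finsupp.induction_linear with
  | zero => simp
  | add v w hv hw => simp only [map_add, LinearMap.add_apply, hv, hw, smul_add]
  | single N c =>
    have : Finsupp.single N c = c • Finsupp.single N (1 : ℂ) := by simp
    rw [this, map_smul, LinearMap.smul_apply, map_smul, map_smul, ofPoly_act_single, smul_comm]

theorem smul_mem_range_ofPoly (u : UniversalEnvelopingAlgebra ℂ g) :
    ∀ m ∈ LinearMap.range (O.ofPoly χ), u • m ∈ LinearMap.range (O.ofPoly χ) := by
  induction u using enveloping_induction with
  | algebraMap c => intro m hm; rw [algebraMap_smul]; exact Submodule.smul_mem _ c hm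
  | ι x => rintro _ ⟨v, rfl⟩; exact ⟨_, O.ofPoly_act χ v x⟩
  | mul u v hu hv => intro m hm; rw [mul_smul]; exact hu _ (hv m hm)
  | add u v hu hv => intro m hm; rw [add_smul]; exact add_mem (hu m hm) (hv m hm)

theorem span_monomial :
    Submodule.span ℂ (Set.range fun N : Multiset I => O.monomial N • gen χ) = ⊤ := by
  rw [← Finsupp.range_linearCombination, eq_top_iff]
  rintro m -
  obtain ⟨t, rfl⟩ := Submodule.mkQ_surjective _ m
  have hgen : gen χ ∈ LinearMap.range (O.ofPoly χ) :=
    ⟨Finsupp.single 0 1, by rw [ofPoly_single, monomial_zero, one_smul]⟩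
  induction t using TensorProduct.induction_on with
  | zero => rw [map_zero]; exact zero_mem _
  | tmul u c =>
    change InducedModule.tmul H (charRep H χ) u c ∈ LinearMap.range (O.ofPoly χ)
    rw [tmul_eq]
    exact O.smul_mem_range_ofPoly χ _ _ hgen
  | add s t hs ht => rw [map_add]; exact add_mem hs ht

/-! ### Linear independence of ordered monomials -/

/-- The action of the enveloping algebra on polynomials. -/
def envRep : UniversalEnvelopingAlgebra ℂ g →ₐ[ℂ] Module.End ℂ (Multiset I →₀ ℂ) :=
  UniversalEnvelopingAlgebra.lift ℂ (O.rep χ)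

theorem envRep_ι (x : g) (v : Multiset I →₀ ℂ) :
    O.envRep χ (UniversalEnvelopingAlgebra.ι ℂ x) v = O.act χ v x := by
  rw [envRep, UniversalEnvelopingAlgebra.lift_ι_apply, rep_apply]

/-- Applied from right to left, each factor of the ordered product meets only variables at least as
large and therefore multiplies. -/
theorem envRep_monomial (N : Multiset I) :
    O.envRep χ (O.monomial N) (Finsupp.single 0 1) = Finsupp.single N 1 := by
  induction hk : N.card generalizing N with
  | zero => rw [Multiset.card_eq_zero.1 hk, monomial_zero, map_one, Module.End.one_apply]
  | succ k ih =>
    rcases eq_zero_or_exists_cons N with rfl | ⟨j, N', rfl, hj⟩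
    · simp at hk
    · rw [O.monomial_cons hj, map_mul, Module.End.mul_apply, ih N' (by simpa using hk), envRep_ι,
        O.act_z_of_le χ hj]

/-- Constants form a copy of the inducing representation of `H`; this is what makes evaluation on
constants compatible with the tensor product over U(H). -/
theorem envRep_envelopingIncl (b : UniversalEnvelopingAlgebra ℂ H) :
    ∀ c : ℂ, O.envRep χ (envelopingIncl H b) (Finsupp.single 0 c) =
      Finsupp.single 0 (UniversalEnvelopingAlgebra.lift ℂ (charRep H χ) b c) := by
  induction b using enveloping_induction with
  | algebraMap r => intro c; simp
  | ι x =>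
    intro c
    have : Finsupp.single (0 : Multiset I) c = c • Finsupp.single 0 (1 : ℂ) := by simp
    rw [envelopingIncl, UniversalEnvelopingAlgebra.lift_ι_apply,
      UniversalEnvelopingAlgebra.lift_ι_apply, LieHom.comp_apply, envRep_ι, this, map_smul,
      LinearMap.smul_apply, LieSubalgebra.coe_incl, O.act_zero_of_mem χ x.2]
    simp [charRep, mul_comm]
  | mul u v hu hv => intro c; simp only [map_mul, Module.End.mul_apply, hv, hu]
  | add u v hu hv => intro c; simp only [map_add, LinearMap.add_apply, hv, hu, Finsupp.single_add]

/-- The linear map from `U(g) ⊗ ℂ` to polynomials given by the action on constants. -/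
def toPolyAux : (UniversalEnvelopingAlgebra ℂ g ⊗[ℂ] ℂ) →ₗ[ℂ] (Multiset I →₀ ℂ) :=
  TensorProduct.lift ((LinearMap.llcomp ℂ ℂ _ _).flip (Finsupp.lsingle 0) ∘ₗ
    (O.envRep χ).toLinearMap)

theorem toPolyAux_tmul (u : UniversalEnvelopingAlgebra ℂ g) (c : ℂ) :
    O.toPolyAux χ (u ⊗ₜ c) = O.envRep χ u (Finsupp.single 0 c) := rfl

theorem toPolyAux_smul (u : UniversalEnvelopingAlgebra ℂ g)
    (t : UniversalEnvelopingAlgebra ℂ g ⊗[ℂ] ℂ) :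
    O.toPolyAux χ (u • t) = O.envRep χ u (O.toPolyAux χ t) := by
  induction t using TensorProduct.induction_on with
  | zero => simp
  | tmul v c => rw [TensorProduct.smul_tmul', toPolyAux_tmul, toPolyAux_tmul, smul_eq_mul, map_mul,
      Module.End.mul_apply]
  | add s t hs ht => rw [smul_add, map_add, map_add, map_add, hs, ht]

theorem toPolyAux_eq_zero {t : UniversalEnvelopingAlgebra ℂ g ⊗[ℂ] ℂ}
    (ht : t ∈ inducedRelations H (charRep H χ)) : O.toPolyAux χ t = 0 := by
  rw [inducedRelations] at ht
  induction ht using Submodule.span_induction with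
  | zero => exact map_zero _
  | add s t _ _ hs ht => rw [map_add, hs, ht, add_zero]
  | smul u t _ ht => rw [toPolyAux_smul, ht, map_zero]
  | mem t ht =>
    obtain ⟨u, b, v, rfl⟩ := ht
    rw [map_sub, toPolyAux_tmul, toPolyAux_tmul, map_mul, Module.End.mul_apply,
      envRep_envelopingIncl, sub_self]

theorem linearIndependent_monomial :
    LinearIndependent ℂ fun N : Multiset I => O.monomial N • gen χ := by
  rw [linearIndependent_iff]
  intro v hv
  -- A vanishing combination is lifted to U(g) ⊗ ℂ, where it lies in the relations; `toPolyAux`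
  -- kills it and also returns its coefficients.
  have h1 : Finsupp.linearCombination ℂ (fun N : Multiset I => O.monomial N • gen χ) v =
      (inducedRelations H (charRep H χ)).mkQ
        (Finsupp.linearCombination ℂ (fun N => O.monomial N ⊗ₜ[ℂ] (1 : ℂ)) v) := by
    rw [Finsupp.linearCombination_apply, Finsupp.linearCombination_apply, Finsupp.sum, Finsupp.sum,
      map_sum]
    refine Finset.sum_congr rfl fun N _ => ?_
    have := tmul_eq χ (v N • O.monomial N) 1
    rw [one_smul, smul_assoc] at this
    rw [← this, TensorProduct.smul_tmul']
    rfl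
  rw [h1] at hv
  have h2 := O.toPolyAux_eq_zero χ ((Submodule.Quotient.mk_eq_zero _).1 hv)
  rw [Finsupp.linearCombination_apply, Finsupp.sum, map_sum] at h2
  simp only [map_smul, toPolyAux_tmul, envRep_monomial] at h2
  rw [← h2]
  conv_lhs => rw [← Finsupp.sum_single v, Finsupp.sum]
  simp

end OrderedComplement

/-! ### Monomials with three families of exponents -/

section Word

variable (p q r : ℕ →₀ ℕ)

/-- The sorted list in which `(i, 0)`, `(i, 1)`, `(i, 2)` occur `p i`, `q i`, `r i` times. -/
def word : List (ℕ ×ₗ Fin 3) :=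
  ((p.support ∪ q.support ∪ r.support).sort (· ≤ ·)).flatMap fun i =>
    List.replicate (p i) (toLex (i, 0)) ++ List.replicate (q i) (toLex (i, 1)) ++
      List.replicate (r i) (toLex (i, 2))

theorem mem_block {i : ℕ} {a b c : ℕ} {x : ℕ ×ₗ Fin 3}
    (h : x ∈ List.replicate a (toLex (i, (0 : Fin 3))) ++ List.replicate b (toLex (i, 1)) ++
      List.replicate c (toLex (i, 2))) : (ofLex x).1 = i := by
  simp only [List.mem_append, List.mem_replicate] at h
  rcases h with (⟨-, rfl⟩ | ⟨-, rfl⟩) | ⟨-, rfl⟩ <;> rfl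

theorem pairwise_word : (word p q r).Pairwise (· ≤ ·) := by
  rw [word, List.pairwise_flatMap]
  constructor
  · intro i _
    simp only [List.pairwise_append, List.pairwise_replicate, List.mem_append, List.mem_replicate]
    refine ⟨⟨Or.inr le_rfl, Or.inr le_rfl, ?_⟩, Or.inr le_rfl, ?_⟩
    · rintro _ ⟨-, rfl⟩ _ ⟨-, rfl⟩
      simp [Prod.Lex.toLex_le_toLex]
    · rintro _ (⟨-, rfl⟩ | ⟨-, rfl⟩) _ ⟨-, rfl⟩ <;> simp [Prod.Lex.toLex_le_toLex]
  · refine (Finset.sortedLT_sort _).pairwise.imp ?_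
    intro i j hij x hx y hy
    rw [Prod.Lex.le_iff]
    left
    rw [mem_block hx, mem_block hy]
    exact hij

theorem sort_word : (word p q r : Multiset (ℕ ×ₗ Fin 3)).sort (· ≤ ·) = word p q r := by
  rw [Multiset.coe_sort]
  exact List.mergeSort_eq_self _ (pairwise_word p q r)

theorem count_word (i : ℕ) (t : Fin 3) :
    (word p q r : Multiset (ℕ ×ₗ Fin 3)).count (toLex (i, t)) = (![p, q, r] t) i := by
  have hf (j : ℕ) : Multiset.count (toLex (i, t))
      (List.replicate (p j) (toLex (j, (0 : Fin 3))) ++ List.replicate (q j) (toLex (j, 1)) ++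
        List.replicate (r j) (toLex (j, 2)) : List (ℕ ×ₗ Fin 3)) =
      if j = i then (![p, q, r] t) i else 0 := by
    rw [← Multiset.coe_add, ← Multiset.coe_add, Multiset.coe_replicate, Multiset.coe_replicate,
      Multiset.coe_replicate, Multiset.count_add, Multiset.count_add, Multiset.count_replicate,
      Multiset.count_replicate, Multiset.count_replicate]
    by_cases h : j = i
    · subst h
      fin_cases t <;> simp
    · simp [h]
  rw [word, ← Multiset.coe_bind, Multiset.count_bind, Finset.sort_eq,
    Multiset.map_congr rfl fun j _ => hf j]
  change ∑ j ∈ _, _ = _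
  rw [Finset.sum_ite_eq']
  split_ifs with h
  · rfl
  · simp only [Finset.mem_union, Finsupp.mem_support_iff, not_or, not_not] at h
    fin_cases t <;> simp [h]

/-- The exponents are the multiplicities of the letters, so a multiset determines them and arises
from them. -/
theorem bijective_word : Function.Bijective fun x : (ℕ →₀ ℕ) × (ℕ →₀ ℕ) × (ℕ →₀ ℕ) =>
    (word x.1 x.2.1 x.2.2 : Multiset (ℕ ×ₗ Fin 3)) := by
  constructor
  · rintro ⟨p, q, r⟩ ⟨p', q', r'⟩ h
    have h' (i : ℕ) (t : Fin 3) : (![p, q, r] t) i = (![p', q', r'] t) i := by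
      rw [← count_word, ← count_word]
      exact congrArg _ h
    simp only [Prod.mk.injEq]
    exact ⟨Finsupp.ext fun i => h' i 0, Finsupp.ext fun i => h' i 1, Finsupp.ext fun i => h' i 2⟩
  · intro N
    let e (t : Fin 3) : ℕ →₀ ℕ := (Multiset.toFinsupp N).comapDomain (fun i => toLex (i, t))
      (fun i _ j _ h => by simpa using h)
    refine ⟨(e 0, e 1, e 2), Multiset.ext.2 fun x => ?_⟩
    obtain ⟨⟨i, t⟩, rfl⟩ := toLex.surjective x
    refine (count_word _ _ _ i t).trans ?_
    have he (t : Fin 3) : e t i = N.count (toLex (i, t)) :=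
      (Finsupp.comapDomain_apply _ _ _ _).trans (Multiset.toFinsupp_apply _ _)
    fin_cases t <;> exact he _

end Word

/-! ### Complements indexed by ℕ × Fin 3 -/

namespace OrderedComplement

variable {g : Type*} [LieRing g] [LieAlgebra ℂ g] {H : LieSubalgebra ℂ g}

/-- A complement from its coordinates, if the elements whose decomposition is known span. -/
def ofSpan {I : Type*} (z : I → g) (coord : g →ₗ[ℂ] I →₀ ℂ)
    (coord_z : ∀ i, coord (z i) = Finsupp.single i 1) (coord_H : ∀ x ∈ H, coord x = 0)
    (S : Set g) (hS : Submodule.span ℂ S = ⊤) (h : ∀ x ∈ S, x ∈ H ∨ ∃ i, x = z i) :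
    OrderedComplement H I where
  z := z
  coord := coord
  proj := (LinearMap.id - Finsupp.linearCombination ℂ z ∘ₗ coord).codRestrict H.toSubmodule <| by
    -- Subtracting the coordinate part kills each `z i` and fixes `H`, so it maps a spanning set
    -- into `H`.
    have : (⊤ : Submodule ℂ g) ≤
        H.toSubmodule.comap (LinearMap.id - Finsupp.linearCombination ℂ z ∘ₗ coord) := by
      rw [← hS, Submodule.span_le]
      intro x hx
      rcases h x hx with hx | ⟨i, rfl⟩
      · simpa [coord_H x hx] using hx
      · simp [coord_z]
    exact fun x => this trivial
  decomp x := by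
    change Finsupp.linearCombination ℂ z (coord x) +
      (x - Finsupp.linearCombination ℂ z (coord x)) = x
    exact add_sub_cancel _ _
  coord_z := coord_z
  coord_H := coord_H

theorem monomial_word (O : OrderedComplement H (ℕ ×ₗ Fin 3)) (p q r : ℕ →₀ ℕ) :
    O.monomial (word p q r) = (((p.support ∪ q.support ∪ r.support).sort (· ≤ ·)).map fun i =>
      UniversalEnvelopingAlgebra.ι ℂ (O.z (toLex (i, 0))) ^ p i *
      UniversalEnvelopingAlgebra.ι ℂ (O.z (toLex (i, 1))) ^ q i *
      UniversalEnvelopingAlgebra.ι ℂ (O.z (toLex (i, 2))) ^ r i).prod := by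
  rw [monomial, sort_word, word]
  simp [List.flatMap, List.prod_flatten, List.map_map, Function.comp_def, mul_assoc]

theorem linearIndependent_word (O : OrderedComplement H (ℕ ×ₗ Fin 3)) (χ : H →ₗ⁅ℂ⁆ ℂ) :
    LinearIndependent ℂ fun x : (ℕ →₀ ℕ) × (ℕ →₀ ℕ) × (ℕ →₀ ℕ) =>
      O.monomial (word x.1 x.2.1 x.2.2) • gen χ :=
  (O.linearIndependent_monomial χ).comp _ bijective_word.1

theorem span_word (O : OrderedComplement H (ℕ ×ₗ Fin 3)) (χ : H →ₗ⁅ℂ⁆ ℂ) :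
    Submodule.span ℂ (Set.range fun x : (ℕ →₀ ℕ) × (ℕ →₀ ℕ) × (ℕ →₀ ℕ) =>
      O.monomial (word x.1 x.2.1 x.2.2) • gen χ) = ⊤ := by
  rw [← O.span_monomial χ]
  congr 1
  exact bijective_word.2.range_comp fun N => O.monomial N • gen χ

end OrderedComplement

/-! ### The complement of `N` in affine `sl₂` -/

/-- The elements `e₋ᵢ₋₁`, `h₋ᵢ`, `f₋ᵢ`. -/
def affZ (x : ℕ ×ₗ Fin 3) : AffineSl2 :=
  ![loop sl2E (-(ofLex x).1 - 1), loop sl2H (-(ofLex x).1), loop sl2F (-(ofLex x).1)] (ofLex x).2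

/-- The entry of a matrix in `sl₂` as a linear functional. -/
def sl2Entry (i j : Fin 2) : Sl2 →ₗ[ℂ] ℂ :=
  Matrix.entryLinearMap ℂ ℂ i j ∘ₗ (LieAlgebra.SpecialLinear.sl (Fin 2) ℂ).toSubmodule.subtype

theorem sl2Entry_apply (i j : Fin 2) (x : Sl2) : sl2Entry i j x = x.1 i j := rfl

/-- The coordinates of `x ⊗ tⁿ` with respect to `affZ`. -/
def affCoordAt (n : ℤ) : Sl2 →ₗ[ℂ] (ℕ ×ₗ Fin 3) →₀ ℂ :=
  -- The bound for e is -1 and the index is shifted by one because e₀ lies in `N`, whereas h₀ and f₀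
  -- do not. The upper left entry is the coefficient of h.
  (sl2Entry 0 1).smulRight
      (if n ≤ -1 then Finsupp.single (toLex ((-n - 1).toNat, (0 : Fin 3))) 1 else 0) +
    (sl2Entry 0 0).smulRight
      (if n ≤ 0 then Finsupp.single (toLex ((-n).toNat, (1 : Fin 3))) 1 else 0) +
    (sl2Entry 1 0).smulRight
      (if n ≤ 0 then Finsupp.single (toLex ((-n).toNat, (2 : Fin 3))) 1 else 0)

/-- The coordinates with respect to `affZ` modulo `affN`. -/
def affCoord : AffineSl2 →ₗ[ℂ] (ℕ ×ₗ Fin 3) →₀ ℂ :=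
  Finsupp.lsum ℂ affCoordAt ∘ₗ (LieAlgebra.LoopAlgebra.toFinsupp ℂ ℤ Sl2).toLinearMap ∘ₗ
    LinearMap.fst ℂ _ _ ∘ₗ affOf.symm.toLinearMap

theorem affCoord_loop (x : Sl2) (n : ℤ) : affCoord (loop x n) = affCoordAt n x := by
  change Finsupp.lsum ℂ affCoordAt (LieAlgebra.LoopAlgebra.toFinsupp ℂ ℤ Sl2
    (AddMonoidAlgebra.single n 1 ⊗ₜ[ℂ] x)) = _
  rw [LieAlgebra.LoopAlgebra.toFinsupp_single_tmul, Finsupp.lsum_single]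

theorem affCoord_affK : affCoord affK = 0 := by
  simp [affCoord, affK]

theorem affCoordAt_E (n : ℤ) : affCoordAt n sl2E =
    if n ≤ -1 then Finsupp.single (toLex ((-n - 1).toNat, (0 : Fin 3))) 1 else 0 := by
  simp [affCoordAt, sl2Entry_apply, sl2E]

theorem affCoordAt_H (n : ℤ) : affCoordAt n sl2H =
    if n ≤ 0 then Finsupp.single (toLex ((-n).toNat, (1 : Fin 3))) 1 else 0 := by
  simp [affCoordAt, sl2Entry_apply, sl2H]

theorem affCoordAt_F (n : ℤ) : affCoordAt n sl2F =
    if n ≤ 0 then Finsupp.single (toLex ((-n).toNat, (2 : Fin 3))) 1 else 0 := by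
  simp [affCoordAt, sl2Entry_apply, sl2F]

theorem sl2_eq (x : Sl2) : x = x.1 0 1 • sl2E + x.1 0 0 • sl2H + x.1 1 0 • sl2F := by
  have hx : x.1 0 0 + x.1 1 1 = 0 := by
    rw [← Matrix.trace_fin_two]
    exact x.2
  ext i j
  fin_cases i <;> fin_cases j <;> simp [sl2E, sl2H, sl2F]
  linear_combination hx

/-- The elements `eₙ`, `hₙ`, `fₙ` and `K`. -/
def affSpanning : Set AffineSl2 :=
  {x | (∃ n : ℤ, x = loop sl2E n ∨ x = loop sl2H n ∨ x = loop sl2F n) ∨ x = affK}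

theorem loop_add (x y : Sl2) (n : ℤ) : loop (x + y) n = loop x n + loop y n := by
  rw [loop, loop, loop, ← map_add, TensorProduct.tmul_add, Prod.mk_add_mk, add_zero]

theorem span_affSpanning : Submodule.span ℂ affSpanning = ⊤ := by
  have hloop (x : Sl2) (n : ℤ) : loop x n ∈ Submodule.span ℂ affSpanning := by
    rw [sl2_eq x, loop_add, loop_add, loop_smul, loop_smul, loop_smul]
    refine add_mem (add_mem ?_ ?_) ?_ <;> refine Submodule.smul_mem _ _ (Submodule.subset_span ?_)
    · exact Or.inl ⟨n, Or.inl rfl⟩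
    · exact Or.inl ⟨n, Or.inr (Or.inl rfl)⟩
    · exact Or.inl ⟨n, Or.inr (Or.inr rfl)⟩
  rw [eq_top_iff]
  rintro x -
  obtain ⟨⟨y, c⟩, rfl⟩ := affOf.surjective x
  have h1 : affOf (y, c) = affOf (y, 0) + c • affK := by
    rw [affK, ← map_smul, ← map_add]; simp
  rw [h1]
  refine add_mem ?_ (Submodule.smul_mem _ _ (Submodule.subset_span (Or.inr rfl)))
  clear h1
  obtain ⟨f, rfl⟩ := (LieAlgebra.LoopAlgebra.toFinsupp ℂ ℤ Sl2).symm.surjective y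
  induction f using Finsupp.induction_linear with
  | zero =>
    rw [map_zero]
    exact (map_zero affOf).symm ▸ zero_mem _
  | add f f' hf hf' =>
    rw [map_add, ← add_zero (0 : ℂ), ← Prod.mk_add_mk, map_add]
    exact add_mem hf hf'
  | single n x =>
    rw [LieAlgebra.LoopAlgebra.toFinsupp_symm_single]
    exact hloop x n

/-- The complement of `N` in affine `sl₂` with basis `e₋ᵢ₋₁`, `h₋ᵢ`, `f₋ᵢ`. -/
def affComplement : OrderedComplement affN (ℕ ×ₗ Fin 3) :=
  .ofSpan affZ affCoord
    (by
      intro x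
      obtain ⟨⟨i, t⟩, rfl⟩ := toLex.surjective x
      fin_cases t <;> simp [affZ, affCoord_loop, affCoordAt_E, affCoordAt_H, affCoordAt_F])
    (by
      have : Submodule.span ℂ affGens ≤ LinearMap.ker affCoord := by
        rw [Submodule.span_le]
        rintro x (⟨n, rfl | rfl | rfl⟩ | rfl)
        · have : ¬ (n : ℤ) ≤ -1 := by omega
          simp [affCoord_loop, affCoordAt_E, this]
        · have : ¬ (n : ℤ) + 1 ≤ 0 := by omega
          simp [affCoord_loop, affCoordAt_F, this]
        · have : ¬ (n : ℤ) + 1 ≤ 0 := by omega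
          simp [affCoord_loop, affCoordAt_H, this]
        · exact affCoord_affK
      exact fun x hx => this hx)
    affSpanning span_affSpanning
    (by
      have hN {x : AffineSl2} (hx : x ∈ affGens) : x ∈ affN := Submodule.subset_span hx
      rintro x (⟨n, rfl | rfl | rfl⟩ | rfl)
      · rcases le_or_gt 0 n with h | h
        · obtain ⟨m, rfl⟩ := Int.eq_ofNat_of_zero_le h
          exact Or.inl (hN (Or.inl ⟨m, Or.inl rfl⟩))
        · refine Or.inr ⟨toLex ((-n - 1).toNat, 0), ?_⟩
          change _ = loop sl2E _
          congr 1
          dsimp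
          omega
      · rcases le_or_gt n 0 with h | h
        · refine Or.inr ⟨toLex ((-n).toNat, 1), ?_⟩
          change _ = loop sl2H _
          congr 1
          dsimp
          omega
        · obtain ⟨m, rfl⟩ := Int.eq_succ_of_zero_lt h
          exact Or.inl (hN (Or.inl ⟨m, Or.inr (Or.inr rfl)⟩))
      · rcases le_or_gt n 0 with h | h
        · refine Or.inr ⟨toLex ((-n).toNat, 2), ?_⟩
          change _ = loop sl2F _
          congr 1
          dsimp
          omega
        · obtain ⟨m, rfl⟩ := Int.eq_succ_of_zero_lt h
          exact Or.inl (hN (Or.inl ⟨m, Or.inr (Or.inl rfl)⟩))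
      · exact Or.inl (hN (Or.inr rfl)))

theorem affPBW_eq (k lam mu : ℂ) (κ l m : ℕ →₀ ℕ) : affPBW k lam mu κ l m =
    affComplement.monomial (word κ l m) • OrderedComplement.gen (affChar k lam mu) := by
  rw [OrderedComplement.monomial_word]
  rfl

/-! ### The complement of `N_𝓛` in the Virasoro algebra -/

/-- The elements `L₋₃ᵢ`, `L₋₃ᵢ₋₁`, `L₋₃ᵢ₋₂`. -/
def virZ (x : ℕ ×ₗ Fin 3) : Virasoro :=
  ![Virasoro.L (-3 * (ofLex x).1), Virasoro.L (-3 * (ofLex x).1 - 1),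
    Virasoro.L (-3 * ((ofLex x).1 + 1) + 1)] (ofLex x).2

/-- The coordinates with respect to `virZ` modulo `virN`. -/
def virCoord : Virasoro →ₗ[ℂ] (ℕ ×ₗ Fin 3) →₀ ℂ :=
  -- Division with remainder, -n = 3i + t, gives the index (i, t) of Lₙ.
  Finsupp.linearCombination ℂ (fun n : ℤ => if n ≤ 0 then
    Finsupp.single (toLex ((-n).toNat / 3, Fin.ofNat 3 (-n).toNat)) 1 else 0) ∘ₗ
    LinearMap.fst ℂ _ _ ∘ₗ Virasoro.linearEquivProd.toLinearMap

theorem virCoord_L (n : ℤ) : virCoord (Virasoro.L n) = if n ≤ 0 then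
    Finsupp.single (toLex ((-n).toNat / 3, Fin.ofNat 3 (-n).toNat)) 1 else 0 := by
  change Finsupp.linearCombination ℂ _ (Finsupp.single n 1) = _
  rw [Finsupp.linearCombination_single, one_smul]

theorem virCoord_C : virCoord Virasoro.C = 0 := by
  rw [virCoord, LinearMap.comp_apply]
  exact map_zero _

theorem span_L_C : Submodule.span ℂ (Set.range Virasoro.L ∪ {Virasoro.C}) = ⊤ := by
  rw [eq_top_iff]
  rintro ⟨f, c⟩ -
  have h1 : (⟨f, c⟩ : Virasoro) = ⟨f, 0⟩ + c • Virasoro.C :=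
    Virasoro.linearEquivProd.injective (by
      rw [map_add, map_smul]
      change (f, c) = (f, 0) + c • (0, 1)
      simp)
  rw [h1]
  refine add_mem ?_ (Submodule.smul_mem _ _ (Submodule.subset_span (Or.inr rfl)))
  clear h1
  induction f using Finsupp.induction_linear with
  | zero => exact zero_mem _
  | add f f' hf hf' =>
    have : (⟨f + f', 0⟩ : Virasoro) = ⟨f, 0⟩ + ⟨f', 0⟩ :=
      Virasoro.ext rfl (add_zero 0).symm
    rw [this]
    exact add_mem hf hf'
  | single n a =>
    have : (⟨Finsupp.single n a, 0⟩ : Virasoro) = a • Virasoro.L n :=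
      Virasoro.ext (by simp [Virasoro.wittPart_smul, Virasoro.wittPart_L])
        (by simp [Virasoro.centralPart_smul, Virasoro.centralPart_L])
    rw [this]
    exact Submodule.smul_mem _ _ (Submodule.subset_span (Or.inl ⟨n, rfl⟩))

/-- The three families together enumerate each L₋ₛ with s ≥ 0 once, and the lexicographic order on
(i, t) is the order by s = 3i + t. -/
theorem virZ_eq (i : ℕ) (t : Fin 3) : virZ (toLex (i, t)) = Virasoro.L (-(3 * i + t.val : ℕ)) := by
  fin_cases t
  · change Virasoro.L (-3 * (i : ℤ)) = Virasoro.L (-(3 * i + 0 : ℕ))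
    exact congrArg Virasoro.L (by push_cast; ring)
  · change Virasoro.L (-3 * (i : ℤ) - 1) = Virasoro.L (-(3 * i + 1 : ℕ))
    exact congrArg Virasoro.L (by push_cast; ring)
  · change Virasoro.L (-3 * ((i : ℤ) + 1) + 1) = Virasoro.L (-(3 * i + 2 : ℕ))
    exact congrArg Virasoro.L (by push_cast; ring)

/-- The complement of `N_𝓛` in the Virasoro algebra with basis `L₋ₙ`, `n ≥ 0`. -/
def virComplement : OrderedComplement virN (ℕ ×ₗ Fin 3) :=
  .ofSpan virZ virCoord
    (by
      intro x
      obtain ⟨⟨i, t⟩, rfl⟩ := toLex.surjective x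
      rw [virZ_eq, virCoord_L, if_pos (by omega), neg_neg, Int.toNat_natCast]
      congr 3
      · omega
      · ext
        simp)
    (by
      have : Submodule.span ℂ virGens ≤ LinearMap.ker virCoord := by
        rw [Submodule.span_le]
        rintro x (⟨n, rfl⟩ | rfl)
        · have : ¬ (n : ℤ) + 1 ≤ 0 := by omega
          simp [virCoord_L, this]
        · exact virCoord_C
      exact fun x hx => this hx)
    (Set.range Virasoro.L ∪ {Virasoro.C}) span_L_C
    (by
      have hN {x : Virasoro} (hx : x ∈ virGens) : x ∈ virN := Submodule.subset_span hx
      rintro x (⟨n, rfl⟩ | rfl)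
      · rcases le_or_gt n 0 with h | h
        · refine Or.inr ⟨toLex ((-n).toNat / 3, Fin.ofNat 3 (-n).toNat), ?_⟩
          rw [virZ_eq]
          congr 1
          simp only [Fin.val_ofNat]
          omega
        · obtain ⟨m, rfl⟩ := Int.eq_succ_of_zero_lt h
          exact Or.inl (hN (Or.inl ⟨m, rfl⟩))
      · exact Or.inl (hN (Or.inr rfl)))

/-- The letter matched with e₋ᵢ₋₁ is L₋₃ᵢ₋₂, the last of its block rather than the first, so the
exponents `κ` move to the third place. -/
theorem virPBW_eq (c a b : ℂ) (κ l m : ℕ →₀ ℕ) : virPBW c a b κ l m =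
    virComplement.monomial (word l m κ) • OrderedComplement.gen (virChar c a b) := by
  rw [OrderedComplement.monomial_word, virPBW,
    show κ.support ∪ l.support ∪ m.support = l.support ∪ m.support ∪ κ.support by
      rw [Finset.union_assoc, Finset.union_comm]]
  rfl

/-! ### Comparison of the two bases -/

/-- The basis of the affine Whittaker module given by the vectors `affPBW`. -/
def affBasis (k lam mu : ℂ) :
    Module.Basis ((ℕ →₀ ℕ) × (ℕ →₀ ℕ) × (ℕ →₀ ℕ)) ℂ (WhAff k lam mu) :=
  .mk (affComplement.linearIndependent_word (affChar k lam mu))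
    (affComplement.span_word (affChar k lam mu)).ge

theorem affBasis_apply (k lam mu : ℂ) (κ l m : ℕ →₀ ℕ) :
    affBasis k lam mu (κ, l, m) = affPBW k lam mu κ l m := by
  rw [affPBW_eq, affBasis, Module.Basis.mk_apply]

/-- The basis of the Virasoro Whittaker module given by the vectors `virPBW`. -/
def virBasis (c a b : ℂ) :
    Module.Basis ((ℕ →₀ ℕ) × (ℕ →₀ ℕ) × (ℕ →₀ ℕ)) ℂ (WhVir c a b) :=
  (Module.Basis.mk (virComplement.linearIndependent_word (virChar c a b))
    (virComplement.span_word (virChar c a b)).ge).reindex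
    -- The cyclic permutation (l, m, κ) ↦ (κ, l, m) restores the order of exponents used for the
    -- affine basis.
    ((Equiv.prodAssoc _ _ _).symm.trans (Equiv.prodComm _ _))

theorem virBasis_apply (c a b : ℂ) (κ l m : ℕ →₀ ℕ) :
    virBasis c a b (κ, l, m) = virPBW c a b κ l m := by
  rw [virPBW_eq, virBasis, Module.Basis.reindex_apply, Module.Basis.mk_apply]
  rfl

theorem exists_unique_bijective_of_bases {V W J : Type*} [AddCommGroup V] [Module ℂ V]
    [AddCommGroup W] [Module ℂ W] (B : Module.Basis J ℂ V) (B' : Module.Basis J ℂ W) :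
    ∃ φ : V →ₗ[ℂ] W, (∀ j, φ (B j) = B' j) ∧
      (∀ ψ : V →ₗ[ℂ] W, (∀ j, ψ (B j) = B' j) → ψ = φ) ∧ Function.Bijective φ := by
  have he (j : J) : B.equiv B' (Equiv.refl J) (B j) = B' j := by
    rw [Module.Basis.equiv_apply, Equiv.refl_apply]
  exact ⟨(B.equiv B' (Equiv.refl J)).toLinearMap, he,
    fun ψ hψ => B.ext fun j => (hψ j).trans (he j).symm, (B.equiv B' (Equiv.refl J)).bijective⟩

end WhittakerIso

end

/-- The monomials in the `e₋ᵢ₋₁, h₋ᵢ, f₋ᵢ` applied to the Whittaker vector form a basis of the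
affine Whittaker module, and the unique linear map given on this basis by `affPBW ↦ virPBW` is an
isomorphism. -/
theorem mainTheorem13 (k c lam mu a b : ℂ) (hlam : lam ≠ 0) (hmu : mu ≠ 0)
    (hab : (a, b) ≠ (0, 0)) :
    (LinearIndependent ℂ (fun p : (ℕ →₀ ℕ) × (ℕ →₀ ℕ) × (ℕ →₀ ℕ) =>
        WhittakerIso.affPBW k lam mu p.1 p.2.1 p.2.2) ∧
      Submodule.span ℂ (Set.range (fun p : (ℕ →₀ ℕ) × (ℕ →₀ ℕ) × (ℕ →₀ ℕ) =>
        WhittakerIso.affPBW k lam mu p.1 p.2.1 p.2.2)) = ⊤) ∧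
    ∃ φ : WhittakerIso.WhAff k lam mu →ₗ[ℂ] WhittakerIso.WhVir c a b,
      (∀ κ l m : ℕ →₀ ℕ,
        φ (WhittakerIso.affPBW k lam mu κ l m) = WhittakerIso.virPBW c a b κ l m) ∧
      (∀ ψ : WhittakerIso.WhAff k lam mu →ₗ[ℂ] WhittakerIso.WhVir c a b,
        (∀ κ l m : ℕ →₀ ℕ,
          ψ (WhittakerIso.affPBW k lam mu κ l m) = WhittakerIso.virPBW c a b κ l m) → ψ = φ) ∧
      Function.Bijective φ := by
  have hB : (fun p : (ℕ →₀ ℕ) × (ℕ →₀ ℕ) × (ℕ →₀ ℕ) =>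
      WhittakerIso.affPBW k lam mu p.1 p.2.1 p.2.2) = WhittakerIso.affBasis k lam mu :=
    funext fun p => (WhittakerIso.affBasis_apply k lam mu p.1 p.2.1 p.2.2).symm
  rw [hB]
  refine ⟨⟨Module.Basis.linearIndependent _, Module.Basis.span_eq _⟩, ?_⟩
  have h := WhittakerIso.exists_unique_bijective_of_bases
    (WhittakerIso.affBasis k lam mu) (WhittakerIso.virBasis c a b)
  simp only [Prod.forall, WhittakerIso.affBasis_apply, WhittakerIso.virBasis_apply] at h
  exact h
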